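/- Let $A\ge 2$, let $F:\{1,2,\dots\}\to(0,\infty)$ satisfy $\sum_{k=1}^\infty \frac1{F(k)}=\infty$ and $F(k)/k\to\infty$ as $k\to\infty$, and let $x=(x_1,\dots,x_A)$ be a vector of positive integers. Let $(X(n))_{n\ge0}$ be the generalized Pólya urn with feedback function $F$ for every agent, i.e. the Markov chain on $\mathbb N^A$ with $X(0)=x$ and $$\mathbb P\big(X(n+1)=X(n)+e^{(i)}\,\big|\,X(0),\dots,X(n)\big)=\frac{F(X_i(n))}{F(X_1(n))+\dots+F(X_A(n))},\qquad i=1,\dots,A,$$ where $e^{(i)}$ is the $i$-th unit vector. Extend $F$ to $[1,\infty)$ as the right-continuous step function $F(s)=F(\lfloor s\rfloor)$, and put $a_i(t)=\int_{x_i}^{x_i+t}\frac{ds}{F(s)}$ for $t\ge0$. Then, after possibly enlarging the probability space on which $X$ is defined, there are independent real random variables $U_1,\dots,U_A$ such that, almost surely, $$\big(a_i(n)-a_i(X_i(n))\big)_{i=1}^A\xrightarrow{n\to\infty}\left(U_i-\sum_{k=1}^{x_i-1}\frac1{F(k)}-\min_{1\le j\le A}\Big(U_j-\sum_{k=1}^{x_j-1}\frac1{F(k)}\Big)\right)_{i=1}^A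 .$$ Moreover, for each $i$ the minimum $R_i=\min_{k\ge x_i}F(k)$ exists, the sums $\sum_{k=x_i}^\infty F(k)^{-l}$ with $l\ge2$ are finite, the power series $$\sum_{l=2}^\infty\frac{\lambda^l}{l}\sum_{k=x_i}^\infty\frac1{F(k)^l}$$ in $\lambda$ has radius of convergence $R_i$, and for all real $\lambda$ with $|\lambda|<R_i$ the expectation $\mathbb E\,e^{\lambda U_i}$ is finite and $\log\mathbb E\,e^{\lambda U_i}$ equals the sum of this series. -/

import Mathlib

open Filter MeasureTheory ProbabilityTheory
open scoped Topology

universe u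

/-- The generalized Pólya urn with agents `Fin A`, feedback functions `F i` and initial condition
`x₀`: a Markov chain `X` with state space `Fin A → ℕ`, started in `x₀`, which moves from `x` to
`x + e⁽ⁱ⁾` with probability `F i (x i) / ∑ j, F j (x j)`. The Markov property and the transition
probabilities are expressed on the finite histories `{X 0 = x 0, …, X n = x n}`, in product form,
so that histories of probability zero impose nothing. -/
structure IsPolyaUrn {Ω : Type u} [MeasurableSpace Ω] {A : ℕ} (F : Fin A → ℕ → ℝ)
    (x₀ : Fin A → ℕ) (P : Measure Ω) (X : ℕ → Ω → Fin A → ℕ) : Prop where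
  measurable : ∀ n, Measurable (X n)
  init : ∀ᵐ ω ∂P, X 0 ω = x₀
  step : ∀ (n : ℕ) (x : ℕ → Fin A → ℕ) (i : Fin A),
    P.real {ω | (∀ m ≤ n, X m ω = x m) ∧ X (n + 1) ω = x n + Pi.single i 1} =
      F i (x n i) / (∑ j, F j (x n j)) * P.real {ω | ∀ m ≤ n, X m ω = x m}

/-- `urnClock F x t = ∫_x^{x+t} ds / F(s)`, where `F` is extended from the integers to the half line
as a right-continuous step function. -/
noncomputable def urnClock (F : ℕ → ℝ) (x : ℕ) (t : ℝ) : ℝ :=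
  ∫ s in (x : ℝ)..((x : ℝ) + t), 1 / F ⌊s⌋₊

/-- The coefficients of the power series `∑_{l ≥ 2} (s ^ l / l) ∑_{k ≥ x} F(k)^{-l}` in `s`. -/
noncomputable def cgfCoeff (F : ℕ → ℝ) (x : ℕ) (l : ℕ) : ℝ :=
  if 2 ≤ l then (1 / (l : ℝ)) * ∑' k : ℕ, 1 / F (x + k) ^ l else 0

/-!
Run the urn in continuous time: give the `n`-th step the holding time `ξ n / ∑ j, F (X n j)`, with
standard exponential variables `ξ n` that are independent of `X`. By the memoryless property this
turns the agents into independent pure birth processes, and the time shift of agent `i`,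

  `M i n = (time of the n-th jump) - ∑_{x₀ i ≤ k < X n i} 1 / F k`,

has the limit `U i`, distributed as a sum of independent centred exponential variables with rates
`F k`, `k ≥ x₀ i`. The logarithm of the moment generating function of such a sum is
`∑ k, -(log (1 - s / F k) + s / F k)`, whose expansion in powers of `s` is the asserted series.

The embedding is not constructed from independent clocks. Instead the noise is added to the given
urn, and everything about the joint law is read off from one family of martingales: for
`|s i| < min_{k ≥ x₀ i} F k`,

  `exp ((∑ s i) * (time of the n-th jump)) * ∏ i, ∏_{x₀ i ≤ k < X n i} (1 - s i / F k)`

is a positive martingale with mean one (`lintegral_history_mul_expMart_succ`): the holding time in a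
state of total rate `S` contributes the factor `S / (S - ∑ s i)`, the choice of the growing agent
its inverse. It is the product over `i` of `exp (s i * M i n)` and of compensated products that converge
to positive constants, because `∑ 1 / F k ^ 2 < ∞`. Martingale convergence for `s` and `-s` gives the
almost sure convergence of `M i n` (`ae_exists_tendsto_timeShift`). Powers of order slightly above one
are bounded in mean, so the mean is preserved in the limit, which yields the joint moment generating
function of the `U i` (`lintegral_exp_sum_limit`). It factorizes, and analytic continuation to the
imaginary axis gives independence (`iIndepFun_of_mgf_eq_prod`).

The rest is a deterministic argument along each trajectory (`tendsto_atTop_and_urnClock_sub`): if the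
shifts `M i n` converge, then `∑ 1 / F k = ∞` forces all agents to infinity, and since the largest
agent is of order `n` and `1 / F k = o(1 / k)`, its mean time may be replaced by that of `n`.
-/

/-! ### The power series of the cumulant generating function -/

theorem tendsto_rate_atTop {F : ℕ → ℝ}
    (hsuper : Tendsto (fun k : ℕ => F k / (k : ℝ)) atTop atTop) : Tendsto F atTop atTop := by
  have h := hsuper.atTop_mul_atTop₀ (tendsto_natCast_atTop_atTop (R := ℝ))
  refine h.congr' ?_
  filter_upwards [eventually_gt_atTop 0] with k hk
  have : (k : ℝ) ≠ 0 := by positivity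
  field_simp

theorem summable_one_div_rate_pow {F : ℕ → ℝ}
    (hsuper : Tendsto (fun k : ℕ => F k / (k : ℝ)) atTop atTop) (x : ℕ) {l : ℕ} (hl : 2 ≤ l) :
    Summable (fun k : ℕ => 1 / F (x + k) ^ l) := by
  have hbig : Summable (fun k : ℕ => 1 / F k ^ l) := by
    refine Summable.of_norm_bounded_eventually_nat
      (Real.summable_one_div_nat_pow.2 (by omega : 1 < l)) ?_
    filter_upwards [hsuper.eventually_ge_atTop 1, eventually_gt_atTop 0] with k hk hk0
    have hk0' : (0 : ℝ) < k := by positivity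
    have hle : (k : ℝ) ≤ F k := by rwa [le_div_iff₀ hk0', one_mul] at hk
    have hF0 : 0 < F k := hk0'.trans_le hle
    rw [Real.norm_of_nonneg (by positivity)]
    gcongr
  have := (summable_nat_add_iff x).2 hbig
  simpa [add_comm] using this

theorem exists_isLeast_rate {F : ℕ → ℝ} (h : Tendsto F atTop atTop) (x : ℕ) :
    ∃ R : ℝ, IsLeast (F '' Set.Ici x) R := by
  obtain ⟨N, hN⟩ := (h.eventually_ge_atTop (F x)).exists_forall_of_atTop
  obtain ⟨k, hk, hmin⟩ := Finset.exists_min_image (Finset.Icc x (max x N)) F ⟨x, by simp⟩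
  refine ⟨F k, ⟨k, by simp_all, rfl⟩, ?_⟩
  rintro _ ⟨m, hm, rfl⟩
  rcases le_total m (max x N) with h1 | h1
  · exact hmin m (by simp_all)
  · exact (hmin x (by simp)).trans (hN m (by omega))

/-- The cumulant generating function of the limiting time shift of an agent started at `x`, i.e. of
a sum of independent centred exponential variables with rates `F x, F (x + 1), …`. -/
noncomputable def shiftCgf (F : ℕ → ℝ) (x : ℕ) (s : ℝ) : ℝ :=
  ∑' k : ℕ, -(Real.log (1 - s / F (x + k)) + s / F (x + k))

/-- The terms of degree at least two of the power series of `-log (1 - u)`. -/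
noncomputable def logTerm (u : ℝ) (l : ℕ) : ℝ := if 2 ≤ l then u ^ l / l else 0

theorem hasSum_logTerm {u : ℝ} (hu : |u| < 1) :
    HasSum (logTerm u) (-(Real.log (1 - u) + u)) := by
  have h := Real.hasSum_pow_div_log_of_abs_lt_one hu
  have h2 : HasSum (fun l : ℕ => u ^ l / (l : ℝ)) (-Real.log (1 - u)) := by
    rw [← hasSum_nat_add_iff' 1]
    simpa using h
  have h3 := h2.sub (hasSum_ite_eq 1 u)
  rw [show -(Real.log (1 - u) + u) = -Real.log (1 - u) - u by ring]
  refine h3.congr_fun ?_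
  intro l
  rcases l with _ | _ | l <;> simp [logTerm]

theorem summable_of_summable_prod {f : ℕ → ℕ → ℝ} {g : ℕ → ℝ}
    (hf : Summable (fun p : ℕ × ℕ => f p.1 p.2)) (hg : ∀ k, HasSum (f k) (g k)) : Summable g :=
  (hf.hasSum.prod_fiberwise hg).summable

/-- Interchange of the order of summation: column sums have the same total as row sums. -/
theorem hasSum_exchange {f : ℕ → ℕ → ℝ} {g h : ℕ → ℝ}
    (hf : Summable (fun p : ℕ × ℕ => f p.1 p.2)) (hg : ∀ k, HasSum (f k) (g k))
    (hh : ∀ l, HasSum (fun k => f k l) (h l)) : HasSum h (∑' k, g k) := by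
  have h1 := hf.hasSum.prod_fiberwise hg
  have h2 := (Equiv.prodComm ℕ ℕ).hasSum_iff.2 hf.hasSum
  rw [h1.tsum_eq]
  exact h2.prod_fiberwise hh

/-- The double series of `shiftCgf` converges absolutely, dominated by
`s ^ 2 / F (x + k) ^ 2 * (|s| / R) ^ (l - 2)`. -/
theorem summable_shift_terms {F : ℕ → ℝ} {x : ℕ} {R s : ℝ}
    (hsum : Summable (fun k : ℕ => 1 / F (x + k) ^ 2))
    (hR : 0 < R) (hle : ∀ k, R ≤ F (x + k)) (hs : |s| < R) :
    Summable (fun p : ℕ × ℕ => logTerm (s / F (x + p.1)) p.2) := by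
  have hq : |s| / R < 1 := (div_lt_one hR).2 hs
  have hq0 : 0 ≤ |s| / R := by positivity
  have hg : Summable (fun l : ℕ => (|s| / R) ^ (l - 2)) := by
    rw [← summable_nat_add_iff 2]
    simpa using summable_geometric_of_lt_one hq0 hq
  have hf : Summable (fun k : ℕ => s ^ 2 * (1 / F (x + k) ^ 2)) := hsum.mul_left _
  have hfg := hf.mul_of_nonneg hg (fun k => by positivity) (fun l => by positivity)
  refine Summable.of_norm_bounded hfg ?_
  rintro ⟨k, l⟩
  have hF : 0 < F (x + k) := hR.trans_le (hle k)
  unfold logTerm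
  dsimp only
  split_ifs with hl
  · obtain ⟨m, rfl⟩ := Nat.exists_eq_add_of_le hl
    have h1 : |s| / F (x + k) ≤ |s| / R := by gcongr; exact hle k
    rw [norm_div, norm_pow, norm_div, Real.norm_eq_abs, Real.norm_of_nonneg hF.le, pow_add]
    have h2 : (|s| / F (x + k)) ^ 2 = s ^ 2 * (1 / F (x + k) ^ 2) := by
      rw [div_pow, sq_abs]; ring
    rw [h2]
    refine (div_le_self (by positivity) ?_).trans ?_
    · rw [Real.norm_of_nonneg (by positivity)]
      exact_mod_cast (by omega : 1 ≤ 2 + m)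
    · rw [Nat.add_sub_cancel_left]
      gcongr
  · rw [norm_zero]; positivity

section

variable {F : ℕ → ℝ} {x : ℕ} {R s : ℝ}

theorem abs_div_rate_lt_one (hR : 0 < R) (hle : ∀ k, R ≤ F (x + k)) (hs : |s| < R) (k : ℕ) :
    |s / F (x + k)| < 1 := by
  have hF : 0 < F (x + k) := hR.trans_le (hle k)
  rw [abs_div, abs_of_pos hF, div_lt_one hF]
  exact hs.trans_le (hle k)

theorem hasSum_shiftCgf (hsum : Summable (fun k : ℕ => 1 / F (x + k) ^ 2))
    (hR : 0 < R) (hle : ∀ k, R ≤ F (x + k)) (hs : |s| < R) :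
    HasSum (fun k : ℕ => -(Real.log (1 - s / F (x + k)) + s / F (x + k))) (shiftCgf F x s) :=
  (summable_of_summable_prod (f := fun k l => logTerm (s / F (x + k)) l)
    (summable_shift_terms hsum hR hle hs)
    (fun k => hasSum_logTerm (abs_div_rate_lt_one hR hle hs k))).hasSum

theorem hasSum_cgfCoeff (hsum : ∀ l : ℕ, 2 ≤ l → Summable (fun k : ℕ => 1 / F (x + k) ^ l))
    (hR : 0 < R) (hle : ∀ k, R ≤ F (x + k)) (hs : |s| < R) :
    HasSum (fun l : ℕ => cgfCoeff F x l * s ^ l) (shiftCgf F x s) := by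
  refine hasSum_exchange (f := fun k l => logTerm (s / F (x + k)) l)
    (summable_shift_terms (hsum 2 le_rfl) hR hle hs)
    (fun k => hasSum_logTerm (abs_div_rate_lt_one hR hle hs k)) (fun l => ?_)
  unfold cgfCoeff logTerm
  split_ifs with hl
  · have e : (fun k => (s / F (x + k)) ^ l / (l : ℝ)) =
        fun k => (1 / (l : ℝ) * s ^ l) * (1 / F (x + k) ^ l) := by
      funext k
      rw [div_pow]; ring
    rw [e, show 1 / (l : ℝ) * (∑' k, 1 / F (x + k) ^ l) * s ^ l =
      (1 / (l : ℝ) * s ^ l) * ∑' k, 1 / F (x + k) ^ l by ring]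
    exact (hsum l hl).hasSum.mul_left _
  · simp

theorem prod_Ico_eq_exp_neg_sum (hR : 0 < R) (hle : ∀ k, R ≤ F (x + k)) (hs : |s| < R) (m : ℕ) :
    ∏ k ∈ Finset.Ico x m, (1 - s / F k) * Real.exp (s / F k) =
      Real.exp (-∑ k ∈ Finset.range (m - x),
        -(Real.log (1 - s / F (x + k)) + s / F (x + k))) := by
  rw [Finset.prod_Ico_eq_prod_range, ← Finset.sum_neg_distrib, Real.exp_sum]
  refine Finset.prod_congr rfl fun k _ => ?_
  have := abs_lt.1 (abs_div_rate_lt_one hR hle hs k)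
  rw [neg_neg, Real.exp_add, Real.exp_log (by linarith)]

theorem neg_log_one_sub_add_nonneg {u : ℝ} (hu : |u| < 1) : 0 ≤ -(Real.log (1 - u) + u) := by
  have := Real.log_le_sub_one_of_pos (x := 1 - u) (by linarith [(abs_lt.1 hu).2])
  linarith

/-- The compensated product `∏ (1 - s / F k) exp (s / F k)` converges to the reciprocal of the
moment generating function of the limiting shift. -/
theorem tendsto_prod_Ico (hsum : Summable (fun k : ℕ => 1 / F (x + k) ^ 2))
    (hR : 0 < R) (hle : ∀ k, R ≤ F (x + k)) (hs : |s| < R) :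
    Tendsto (fun m => ∏ k ∈ Finset.Ico x m, (1 - s / F k) * Real.exp (s / F k)) atTop
      (𝓝 (Real.exp (-shiftCgf F x s))) := by
  simp_rw [prod_Ico_eq_exp_neg_sum hR hle hs]
  refine (Real.continuous_exp.tendsto _).comp (Tendsto.neg ?_)
  exact (hasSum_shiftCgf hsum hR hle hs).tendsto_sum_nat.comp (tendsto_sub_atTop_nat x)

theorem antitone_prod_Ico (hR : 0 < R) (hle : ∀ k, R ≤ F (x + k)) (hs : |s| < R) :
    Antitone (fun m => ∏ k ∈ Finset.Ico x m, (1 - s / F k) * Real.exp (s / F k)) := by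
  intro m n hmn
  simp only [prod_Ico_eq_exp_neg_sum hR hle hs, Real.exp_le_exp, neg_le_neg_iff]
  refine Finset.sum_le_sum_of_subset_of_nonneg (by simpa using by omega) fun k _ _ => ?_
  exact neg_log_one_sub_add_nonneg (abs_div_rate_lt_one hR hle hs k)

theorem exp_neg_shiftCgf_le_prod_Ico (hsum : Summable (fun k : ℕ => 1 / F (x + k) ^ 2))
    (hR : 0 < R) (hle : ∀ k, R ≤ F (x + k)) (hs : |s| < R) (m : ℕ) :
    Real.exp (-shiftCgf F x s) ≤ ∏ k ∈ Finset.Ico x m, (1 - s / F k) * Real.exp (s / F k) :=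
  (antitone_prod_Ico hR hle hs).le_of_tendsto (tendsto_prod_Ico hsum hR hle hs) m

end

/-- The radius of convergence is the minimal rate `R`: inside, the coefficients are nonnegative and
the series converges; outside, the summand with `F (x + k) = R` alone diverges. -/
theorem cgfCoeff_radius {F : ℕ → ℝ} {x : ℕ} {R : ℝ}
    (hsum : ∀ l : ℕ, 2 ≤ l → Summable (fun k : ℕ => 1 / F (x + k) ^ l))
    (hR : 0 < R) (hle : ∀ k, R ≤ F (x + k)) (hmem : ∃ k, F (x + k) = R) :
    (FormalMultilinearSeries.ofScalars ℝ (cgfCoeff F x)).radius = ENNReal.ofReal R := by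
  have hnorm : ∀ l, ‖FormalMultilinearSeries.ofScalars ℝ (cgfCoeff F x) l‖ = cgfCoeff F x l := by
    intro l
    rw [FormalMultilinearSeries.ofScalars_norm, Real.norm_of_nonneg]
    unfold cgfCoeff
    split_ifs
    · exact mul_nonneg (by positivity) (tsum_nonneg fun k =>
        one_div_nonneg.2 (pow_nonneg (hR.le.trans (hle k)) _))
    · exact le_rfl
  apply le_antisymm
  · refine ENNReal.le_of_forall_nnreal_lt fun r hr => ?_
    by_contra! hlt
    -- a radius above `R` would make the terms at some `r > R` tend to zero
    have hRr : R < r := by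
      rw [ENNReal.ofReal_lt_coe_iff hR.le] at hlt
      simpa using hlt
    have h0 := (FormalMultilinearSeries.summable_norm_mul_pow _ hr).tendsto_atTop_zero
    obtain ⟨k₀, hk₀⟩ := hmem
    -- Bernoulli: the terms stay above `r / R - 1`, as the `l`-th coefficient is at least `R⁻ˡ / l`.
    have hlow : ∀ᶠ l : ℕ in atTop, r / R - 1 ≤
        ‖FormalMultilinearSeries.ofScalars ℝ (cgfCoeff F x) l‖ * (r : ℝ) ^ l := by
      filter_upwards [eventually_ge_atTop 2] with l hl
      rw [hnorm, cgfCoeff, if_pos hl]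
      have h1 : 1 / R ^ l ≤ ∑' k : ℕ, 1 / F (x + k) ^ l := by
        rw [← hk₀]
        exact (hsum l hl).le_tsum k₀ fun k _ =>
          one_div_nonneg.2 (pow_nonneg (hR.le.trans (hle k)) _)
      have hl0 : (0 : ℝ) < l := by positivity
      have h2 : 1 + (l : ℝ) * (r / R - 1) ≤ (1 + (r / R - 1)) ^ l :=
        one_add_mul_le_pow (by linarith [show (0 : ℝ) ≤ r / R by positivity]) l
      calc (r : ℝ) / R - 1 ≤ (1 / l) * (r / R) ^ l := by
            rw [one_div_mul_eq_div, le_div_iff₀ hl0]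
            ring_nf at h2 ⊢
            linarith
        _ = (1 / l) * (1 / R ^ l) * (r : ℝ) ^ l := by rw [div_pow]; ring
        _ ≤ _ := by gcongr
    have := ge_of_tendsto h0 hlow
    rw [sub_nonpos, div_le_one hR] at this
    linarith
  · refine ENNReal.le_of_forall_nnreal_lt fun r hr => ?_
    have hrR : (r : ℝ) < R := by
      rw [← ENNReal.ofReal_coe_nnreal, ENNReal.ofReal_lt_ofReal_iff hR] at hr
      exact hr
    refine FormalMultilinearSeries.le_radius_of_summable_norm _ ?_
    simp_rw [hnorm]
    exact (hasSum_cgfCoeff hsum hR hle (by rwa [NNReal.abs_eq])).summable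

/-! ### Convergence of the clocks along a trajectory -/

/-- The harmonic-type sum `∑_{1 ≤ k < m} 1 / F k`, the expected time an agent with feedback function
`F` needs to grow from `1` to `m`. -/
noncomputable def meanTime (F : ℕ → ℝ) (m : ℕ) : ℝ := ∑ k ∈ Finset.Ico 1 m, 1 / F k

section

variable {F : ℕ → ℝ}

theorem sum_Ico_eq_meanTime_sub {x m : ℕ} (hx : 1 ≤ x) (hm : x ≤ m) :
    ∑ k ∈ Finset.Ico x m, 1 / F k = meanTime F m - meanTime F x := by
  rw [meanTime, meanTime, eq_sub_iff_add_eq', Finset.sum_Ico_consecutive _ hx hm]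

theorem monotone_meanTime (hF : ∀ k, 1 ≤ k → 0 < F k) : Monotone (meanTime F) := by
  intro a b hab
  refine Finset.sum_le_sum_of_subset_of_nonneg (Finset.Ico_subset_Ico_right hab) fun k hk _ => ?_
  exact one_div_nonneg.2 (hF k (Finset.mem_Ico.1 hk).1).le

theorem tendsto_meanTime (hF : ∀ k, 1 ≤ k → 0 < F k)
    (hnonexpl : ¬ Summable (fun k : ℕ => 1 / F (k + 1))) :
    Tendsto (meanTime F) atTop atTop := by
  have h := (not_summable_iff_tendsto_nat_atTop_of_nonneg
    (fun k => one_div_nonneg.2 (hF (k + 1) (by omega)).le)).1 hnonexpl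
  refine (h.comp (tendsto_sub_atTop_nat 1)).congr fun m => ?_
  rw [meanTime, Finset.sum_Ico_eq_sum_range]
  simp [add_comm]

/-- As `1 / F k = o(1 / k)`, the sum `meanTime F` barely changes when its argument is multiplied by
a bounded factor. -/
theorem tendsto_meanTime_sub (hF : ∀ k, 1 ≤ k → 0 < F k)
    (hsuper : Tendsto (fun k : ℕ => F k / (k : ℝ)) atTop atTop) (C : ℕ) {a b : ℕ → ℕ}
    (ha : Tendsto a atTop atTop) (hab : ∀ᶠ n in atTop, a n ≤ b n)
    (hb : ∀ᶠ n in atTop, b n ≤ C * a n) :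
    Tendsto (fun n => meanTime F (b n) - meanTime F (a n)) atTop (𝓝 0) := by
  rw [Metric.tendsto_atTop']
  intro ε hε
  set K : ℝ := (C + 1) / ε with hK
  have hK0 : 0 < K := by positivity
  -- beyond `N` each summand is at most `1 / (K * a n)`, and there are at most `C * a n` of them
  obtain ⟨N, hN⟩ := (hsuper.eventually_ge_atTop K).exists_forall_of_atTop
  obtain ⟨N', hN'⟩ := ((ha.eventually_ge_atTop (max N 1)).and (hab.and hb)).exists_forall_of_atTop
  refine ⟨N', fun n hn => ?_⟩
  obtain ⟨h1, h2, h3⟩ := hN' n hn.le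
  have ha1 : 1 ≤ a n := (le_max_right _ _).trans h1
  have haN : N ≤ a n := (le_max_left _ _).trans h1
  have ha0 : (0 : ℝ) < a n := by exact_mod_cast ha1
  rw [dist_zero_right, Real.norm_of_nonneg (sub_nonneg.2 (monotone_meanTime hF h2)),
    ← sum_Ico_eq_meanTime_sub ha1 h2]
  calc ∑ k ∈ Finset.Ico (a n) (b n), 1 / F k
      ≤ ∑ _k ∈ Finset.Ico (a n) (b n), 1 / (K * a n) := by
        refine Finset.sum_le_sum fun k hk => ?_
        have hak : a n ≤ k := (Finset.mem_Ico.1 hk).1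
        have hk0 : (0 : ℝ) < k := by exact_mod_cast ha1.trans hak
        have hFk := (le_div_iff₀ hk0).1 (hN k (haN.trans hak))
        refine one_div_le_one_div_of_le (by positivity) (le_trans ?_ hFk)
        gcongr
    _ = (b n - a n : ℕ) / (K * a n) := by simp [div_eq_mul_inv]
    _ ≤ (C * a n : ℕ) / (K * a n) := by
        gcongr
        omega
    _ = C / K := by push_cast; field_simp
    _ < ε := by
        rw [hK, div_div_eq_mul_div, div_lt_iff₀ (by positivity)]
        nlinarith

theorem urnClock_natCast (F : ℕ → ℝ) (x n : ℕ) :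
    urnClock F x (n : ℝ) = ∑ k ∈ Finset.Ico x (x + n), 1 / F k := by
  have key : ∀ k : ℕ,
      IntervalIntegrable (fun s : ℝ => 1 / F ⌊s⌋₊) volume (k : ℝ) ((k + 1 : ℕ) : ℝ) ∧
      ∫ s in (k : ℝ)..((k + 1 : ℕ) : ℝ), 1 / F ⌊s⌋₊ = 1 / F k := by
    intro k
    have hle : (k : ℝ) ≤ ((k + 1 : ℕ) : ℝ) := by push_cast; linarith
    have hcongr : ∀ s ∈ Set.Ioo (k : ℝ) ((k + 1 : ℕ) : ℝ), 1 / F k = 1 / F ⌊s⌋₊ := by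
      intro s hs
      rw [(Nat.floor_eq_iff (k.cast_nonneg.trans hs.1.le)).2 ⟨hs.1.le, by exact_mod_cast hs.2⟩]
    constructor
    · rw [intervalIntegrable_iff_integrableOn_Ioo_of_le hle]
      refine IntegrableOn.congr_fun ?_ hcongr measurableSet_Ioo
      exact integrableOn_const (by simp)
    · rw [intervalIntegral.integral_of_le hle, integral_Ioc_eq_integral_Ioo,
        ← setIntegral_congr_fun measurableSet_Ioo hcongr]
      simp
  have h := intervalIntegral.sum_integral_adjacent_intervals_Ico (a := fun k : ℕ => (k : ℝ))
    (Nat.le_add_right x n) (f := fun s : ℝ => 1 / F ⌊s⌋₊) (μ := volume) fun k _ => (key k).1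
  rw [urnClock, ← Nat.cast_add, ← h]
  exact Finset.sum_congr rfl fun k _ => (key k).2

/-- The convergence of the clocks along a single trajectory: if the shifts between the real time
`t n` and the mean times of the agents converge, then nonexplosion forces all agents to
infinity, and `meanTime F n - t n` converges to the negative of the smallest shift, because the
largest agent is of order `n`. -/
theorem tendsto_atTop_and_urnClock_sub {A : ℕ} [Nonempty (Fin A)] (hF : ∀ k, 1 ≤ k → 0 < F k)
    (hnonexpl : ¬ Summable (fun k : ℕ => 1 / F (k + 1)))
    (hsuper : Tendsto (fun k : ℕ => F k / (k : ℝ)) atTop atTop)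
    {x₀ : Fin A → ℕ} (hx₀ : ∀ i, 1 ≤ x₀ i) {X : ℕ → Fin A → ℕ} {t : ℕ → ℝ} {U : Fin A → ℝ}
    (h0 : X 0 = x₀) (hstep : ∀ n, ∃ i, X (n + 1) = X n + Pi.single i 1)
    (hM : ∀ i, Tendsto (fun n => t n - ∑ k ∈ Finset.Ico (x₀ i) (X n i), 1 / F k) atTop
      (𝓝 (U i))) :
    (∀ i, Tendsto (fun n => X n i) atTop atTop) ∧ Tendsto (fun (n : ℕ) (i : Fin A) =>
      urnClock F (x₀ i) (n : ℝ) - urnClock F (x₀ i) (X n i : ℝ)) atTop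
      (𝓝 fun i : Fin A => (U i - ∑ k ∈ Finset.Ico 1 (x₀ i), 1 / F k) -
        ⨅ j : Fin A, (U j - ∑ k ∈ Finset.Ico 1 (x₀ j), 1 / F k)) := by
  have hmono : ∀ n i, x₀ i ≤ X n i := by
    intro n
    induction n with
    | zero => intro i; rw [h0]
    | succ n ih =>
      intro i
      obtain ⟨j, hj⟩ := hstep n
      rw [hj]
      exact (ih i).trans (Nat.le_add_right _ _)
  set c : ℕ := ∑ i, x₀ i with hc
  have htotal : ∀ n, ∑ i, X n i = n + c := by
    intro n
    induction n with
    | zero => rw [h0]; omega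
    | succ n ih =>
      obtain ⟨j, hj⟩ := hstep n
      rw [hj]
      simp only [Pi.add_apply, Finset.sum_add_distrib, ih, Finset.sum_pi_single']
      simp
      omega
  -- the largest agent holds at least the fraction `1 / A` of the total
  set m : ℕ → ℕ := fun n => Finset.univ.sup (X n) with hm
  have hXm : ∀ n i, X n i ≤ m n := fun n i => Finset.le_sup (Finset.mem_univ i)
  have hmem : ∀ n, ∃ i, X n i = m n := by
    intro n
    obtain ⟨i, -, hi⟩ := Finset.exists_mem_eq_sup Finset.univ Finset.univ_nonempty (X n)
    exact ⟨i, hi.symm⟩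
  have hm1 : ∀ n, m n ≤ n + c := by
    intro n
    obtain ⟨i, hi⟩ := hmem n
    rw [← hi, ← htotal n]
    exact Finset.single_le_sum (fun _ _ => Nat.zero_le _) (Finset.mem_univ i)
  have hm2 : ∀ n, n + c ≤ A * m n := by
    intro n
    rw [← htotal n]
    simpa using Finset.sum_le_card_nsmul Finset.univ (X n) (m n) fun i _ => hXm n i
  have hA : 0 < A := Fin.pos_iff_nonempty.2 inferInstance
  have hmtop : Tendsto m atTop atTop := by
    refine tendsto_atTop.2 fun b => ?_
    filter_upwards [eventually_ge_atTop (A * b)] with n hn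
    have := hm2 n
    by_contra! hlt
    have : A * m n < A * b := Nat.mul_lt_mul_of_pos_left hlt hA
    omega
  set H := meanTime F with hH
  have hHmono : Monotone H := monotone_meanTime hF
  have hHtop : Tendsto H atTop atTop := tendsto_meanTime hF hnonexpl
  have hV : ∀ i, Tendsto (fun n => t n - H (X n i)) atTop (𝓝 (U i - H (x₀ i))) := by
    intro i
    refine ((hM i).sub_const (H (x₀ i))).congr fun n => ?_
    rw [sum_Ico_eq_meanTime_sub (hx₀ i) (hmono n i)]
    ring
  have hinf : Tendsto (fun n => t n - H (m n)) atTop (𝓝 (⨅ j, (U j - H (x₀ j)))) := by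
    have h1 : Tendsto
        (fun n => Finset.univ.inf' Finset.univ_nonempty fun i => t n - H (X n i)) atTop
        (𝓝 (Finset.univ.inf' Finset.univ_nonempty fun i => U i - H (x₀ i))) :=
      Tendsto.finset_inf'_nhds_apply Finset.univ_nonempty fun i _ => hV i
    rw [Finset.inf'_univ_eq_ciInf] at h1
    refine h1.congr fun n => ?_
    apply le_antisymm
    · obtain ⟨i, hi⟩ := hmem n
      rw [← hi]
      exact Finset.inf'_le _ (Finset.mem_univ i)
    · exact Finset.le_inf' _ _ fun i _ => sub_le_sub_left (hHmono (hXm n i)) _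
  have ht : Tendsto t atTop atTop :=
    (hinf.add_atTop (hHtop.comp hmtop)).congr fun n => by simp
  have hXtop : ∀ i, Tendsto (fun n => X n i) atTop atTop := by
    intro i
    have h1 : Tendsto (fun n => H (X n i)) atTop atTop :=
      ((hV i).neg.add_atTop ht).congr fun n => by ring
    refine tendsto_atTop.2 fun b => ?_
    filter_upwards [h1.eventually_gt_atTop (H b)] with n hn
    by_contra! hlt
    exact absurd (hHmono hlt.le) (not_le.2 hn)
  refine ⟨hXtop, tendsto_pi_nhds.2 fun i => ?_⟩
  have e1 : Tendsto (fun n => H (x₀ i + n) - H n) atTop (𝓝 0) :=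
    tendsto_meanTime_sub hF hsuper 2 tendsto_id (Eventually.of_forall fun n => by simp)
      ((eventually_ge_atTop (x₀ i)).mono fun n hn => by omega)
  have e2 : Tendsto (fun n => H (n + c) - H n) atTop (𝓝 0) :=
    tendsto_meanTime_sub hF hsuper 2 tendsto_id (Eventually.of_forall fun n => by simp)
      ((eventually_ge_atTop c).mono fun n hn => by omega)
  have e3 : Tendsto (fun n => H (n + c) - H (m n)) atTop (𝓝 0) :=
    tendsto_meanTime_sub hF hsuper A hmtop (Eventually.of_forall hm1) (Eventually.of_forall hm2)
  have e4 : Tendsto (fun n => H (x₀ i + X n i) - H (X n i)) atTop (𝓝 0) :=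
    tendsto_meanTime_sub hF hsuper 2 (hXtop i) (Eventually.of_forall fun n => by simp)
      (Eventually.of_forall fun n => by have := hmono n i; omega)
  -- the clocks pass through `n`, `n + c`, the largest agent `m n`, the real time and agent `i`
  have e := (((((e1.sub e2).add e3).sub hinf).add (hV i)).sub e4)
  convert e using 1
  · funext n
    rw [urnClock_natCast, urnClock_natCast, sum_Ico_eq_meanTime_sub (hx₀ i) (by omega),
      sum_Ico_eq_meanTime_sub (hx₀ i) (by omega)]
    ring
  · congr 1
    simp only [hH, meanTime]
    ring

end

/-! ### The Markov property and the exponential noise -/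

section

open scoped ENNReal

section

variable {Ω : Type u} [MeasurableSpace Ω] {A : ℕ} {F : ℕ → ℝ} {x₀ : Fin A → ℕ} {P : Measure Ω}
  {X : ℕ → Ω → Fin A → ℕ}

/-- The trajectory of the process `X` up to time `n`. -/
def pathUpTo (X : ℕ → Ω → Fin A → ℕ) (n : ℕ) (ω : Ω) : Fin (n + 1) → Fin A → ℕ := fun m => X m ω

theorem measurable_pathUpTo (hX : ∀ n, Measurable (X n)) (n : ℕ) : Measurable (pathUpTo X n) :=
  measurable_pi_lambda _ fun m => hX m

theorem IsPolyaUrn.step_path (hX : IsPolyaUrn (fun _ => F) x₀ P X) (n : ℕ)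
    (h : Fin (n + 1) → Fin A → ℕ) (i : Fin A) :
    P.real {ω | pathUpTo X n ω = h ∧ X (n + 1) ω = h (Fin.last n) + Pi.single i 1} =
      F (h (Fin.last n) i) / (∑ j, F (h (Fin.last n) j)) * P.real {ω | pathUpTo X n ω = h} := by
  have hpath : ∀ ω, pathUpTo X n ω = h ↔
      ∀ m ≤ n, X m ω = h (Fin.ofNat (n + 1) m) := by
    intro ω
    constructor
    · rintro rfl m hm
      simp [pathUpTo, Nat.mod_eq_of_lt (Nat.lt_succ_of_le hm)]
    · intro hm
      funext m
      simpa [pathUpTo] using hm m (Nat.lt_succ_iff.1 m.2)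
  have := hX.step n (fun m => h (Fin.ofNat (n + 1) m)) i
  have e : Fin.ofNat (n + 1) n = Fin.last n := Fin.ext (by simp)
  simp only [e] at this
  simpa only [hpath] using this

/-- One step of the urn given the past, as an identity of measures: the event that agent `i` wins
the next step thins the law of the past by the winning probability. -/
theorem IsPolyaUrn.map_restrict (hX : IsPolyaUrn (fun _ => F) x₀ P X) [IsProbabilityMeasure P]
    (n : ℕ) (i : Fin A) :
    (P.restrict {ω | X (n + 1) ω = X n ω + Pi.single i 1}).map (pathUpTo X n) =
      (P.map (pathUpTo X n)).withDensity fun h =>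
        ENNReal.ofReal (F (h (Fin.last n) i) / ∑ j, F (h (Fin.last n) j)) := by
  have hmeas := measurable_pathUpTo hX.measurable n
  refine Measure.ext_of_singleton fun h => ?_
  have hset : pathUpTo X n ⁻¹' {h} ∩ {ω | X (n + 1) ω = X n ω + Pi.single i 1} =
      {ω | pathUpTo X n ω = h ∧ X (n + 1) ω = h (Fin.last n) + Pi.single i 1} := by
    ext ω
    simp only [Set.mem_inter_iff, Set.mem_preimage, Set.mem_singleton_iff, Set.mem_ofPred_eq]
    refine and_congr_right ?_
    rintro rfl
    rfl
  rw [Measure.map_apply hmeas (measurableSet_singleton h),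
    Measure.restrict_apply (hmeas (measurableSet_singleton h)), hset,
    withDensity_apply _ (measurableSet_singleton h), lintegral_singleton,
    Measure.map_apply hmeas (measurableSet_singleton h), ← ofReal_measureReal,
    hX.step_path n h i, ENNReal.ofReal_mul' measureReal_nonneg, ofReal_measureReal]
  rfl

/-- The event that agent `i` wins the step from time `n` to time `n + 1`. -/
def winEvent (X : ℕ → Ω → Fin A → ℕ) (n : ℕ) (i : Fin A) : Set Ω :=
  {ω | X (n + 1) ω = X n ω + Pi.single i 1}

theorem measurableSet_winEvent (hX : ∀ n, Measurable (X n)) (n : ℕ) (i : Fin A) :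
    MeasurableSet (winEvent X n i) := by
  have h : Measurable fun z : Fin A → ℕ => z + Pi.single i 1 := measurable_of_countable _
  exact measurableSet_eq_fun (hX _) (h.comp (hX n))

omit [MeasurableSpace Ω] in
theorem pairwise_disjoint_winEvent (X : ℕ → Ω → Fin A → ℕ) (n : ℕ) :
    Pairwise (Function.onFun Disjoint (winEvent X n)) := by
  intro i j hij
  refine Set.disjoint_left.2 fun ω hi hj => hij ?_
  have h : (Pi.single i 1 : Fin A → ℕ) = Pi.single j 1 := by
    rw [winEvent, Set.mem_ofPred_eq] at hi hj
    exact add_left_cancel (hi.symm.trans hj)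
  by_contra hne
  have := congrFun h i
  rw [Pi.single_eq_same, Pi.single_eq_of_ne hne] at this
  exact one_ne_zero this

theorem sum_ofReal_win_prob [Nonempty (Fin A)] (hF : ∀ k, 1 ≤ k → 0 < F k) {z : Fin A → ℕ}
    (hz : ∀ i, 1 ≤ z i) : ∑ i, ENNReal.ofReal (F (z i) / ∑ j, F (z j)) = 1 := by
  have hS : 0 < ∑ j, F (z j) := Finset.sum_pos (fun j _ => hF _ (hz j)) Finset.univ_nonempty
  rw [← ENNReal.ofReal_sum_of_nonneg fun i _ => div_nonneg (hF _ (hz i)).le hS.le,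
    ← Finset.sum_div, div_self hS.ne', ENNReal.ofReal_one]

/-- Almost surely some agent wins each step: the disjoint events `winEvent X n i` have total
probability one. As nothing is assumed about `F 0`, all agents have to be known to be positive. -/
theorem IsPolyaUrn.ae_exists_win (hX : IsPolyaUrn (fun _ => F) x₀ P X) [IsProbabilityMeasure P]
    [Nonempty (Fin A)] (hF : ∀ k, 1 ≤ k → 0 < F k) (n : ℕ)
    (hpos : ∀ᵐ ω ∂P, ∀ i, 1 ≤ X n ω i) : ∀ᵐ ω ∂P, ω ∈ ⋃ i, winEvent X n i := by
  have hmeas := measurable_pathUpTo hX.measurable n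
  have hU : MeasurableSet (⋃ i, winEvent X n i) :=
    MeasurableSet.iUnion fun i => measurableSet_winEvent hX.measurable n i
  have h1 : P (⋃ i, winEvent X n i) = 1 := by
    rw [measure_iUnion (pairwise_disjoint_winEvent X n)
      (measurableSet_winEvent hX.measurable n), tsum_fintype]
    have h2 : ∀ i, P (winEvent X n i) =
        ∫⁻ ω, ENNReal.ofReal (F (X n ω i) / ∑ j, F (X n ω j)) ∂P := by
      intro i
      have h3 := congrArg (fun μ => μ Set.univ) (hX.map_restrict n i)
      simp only [withDensity_apply _ MeasurableSet.univ, Measure.restrict_univ] at h3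
      rw [Measure.map_apply hmeas MeasurableSet.univ, Set.preimage_univ,
        Measure.restrict_apply_univ, lintegral_map (measurable_of_countable _) hmeas] at h3
      exact h3
    simp_rw [h2]
    rw [← lintegral_finsetSum]
    · rw [lintegral_congr_ae (g := fun _ => 1), lintegral_one, measure_univ]
      filter_upwards [hpos] with ω hω
      exact sum_ofReal_win_prob hF hω
    · intro i _
      exact (measurable_of_countable fun z : Fin A → ℕ =>
        ENNReal.ofReal (F (z i) / ∑ j, F (z j))).comp (hX.measurable n)
  exact (prob_compl_eq_zero_iff hU).2 h1

theorem IsPolyaUrn.ae_le (hX : IsPolyaUrn (fun _ => F) x₀ P X) [IsProbabilityMeasure P]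
    [Nonempty (Fin A)] (hF : ∀ k, 1 ≤ k → 0 < F k) (hx₀ : ∀ i, 1 ≤ x₀ i) (n : ℕ) :
    ∀ᵐ ω ∂P, ∀ i, x₀ i ≤ X n ω i := by
  induction n with
  | zero => filter_upwards [hX.init] with ω hω i using by rw [hω]
  | succ n ih =>
    filter_upwards [ih, hX.ae_exists_win hF n
      (ih.mono fun ω h i => (hx₀ i).trans (h i))] with ω h1 h2 i
    obtain ⟨j, hj⟩ := Set.mem_iUnion.1 h2
    rw [show X (n + 1) ω = X n ω + Pi.single j 1 from hj]
    exact (h1 i).trans (Nat.le_add_right _ _)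

theorem IsPolyaUrn.ae_win (hX : IsPolyaUrn (fun _ => F) x₀ P X) [IsProbabilityMeasure P]
    [Nonempty (Fin A)] (hF : ∀ k, 1 ≤ k → 0 < F k) (hx₀ : ∀ i, 1 ≤ x₀ i) (n : ℕ) :
    ∀ᵐ ω ∂P, ω ∈ ⋃ i, winEvent X n i :=
  hX.ae_exists_win hF n ((hX.ae_le hF hx₀ n).mono fun _ h i => (hx₀ i).trans (h i))

/-- The Markov property in integrated form. -/
theorem IsPolyaUrn.lintegral_step (hX : IsPolyaUrn (fun _ => F) x₀ P X) [IsProbabilityMeasure P]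
    [Nonempty (Fin A)] (hF : ∀ k, 1 ≤ k → 0 < F k) (hx₀ : ∀ i, 1 ≤ x₀ i) (n : ℕ)
    (g : (Fin (n + 1) → Fin A → ℕ) → (Fin A → ℕ) → ℝ≥0∞) :
    ∫⁻ ω, g (pathUpTo X n ω) (X (n + 1) ω) ∂P =
      ∫⁻ ω, ∑ i, ENNReal.ofReal (F (X n ω i) / ∑ j, F (X n ω j)) *
        g (pathUpTo X n ω) (X n ω + Pi.single i 1) ∂P := by
  have hmeas := measurable_pathUpTo hX.measurable n
  have key : ∀ i, ∫⁻ ω in winEvent X n i, g (pathUpTo X n ω) (X (n + 1) ω) ∂P =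
      ∫⁻ ω, ENNReal.ofReal (F (X n ω i) / ∑ j, F (X n ω j)) *
        g (pathUpTo X n ω) (X n ω + Pi.single i 1) ∂P := by
    intro i
    have h1 : ∫⁻ ω in winEvent X n i, g (pathUpTo X n ω) (X (n + 1) ω) ∂P =
        ∫⁻ ω in winEvent X n i,
          (fun h => g h (h (Fin.last n) + Pi.single i 1)) (pathUpTo X n ω) ∂P := by
      refine setLIntegral_congr_fun (measurableSet_winEvent hX.measurable n i) fun ω hω => ?_
      rw [show X (n + 1) ω = X n ω + Pi.single i 1 from hω]
      rfl
    have h3 := lintegral_map (μ := P.restrict (winEvent X n i))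
      (f := fun h => g h (h (Fin.last n) + Pi.single i 1)) (measurable_of_countable _) hmeas
    rw [h1, ← h3]
    have h2 := hX.map_restrict n i
    rw [winEvent, h2, lintegral_withDensity_eq_lintegral_mul _ (measurable_of_countable _)
      (measurable_of_countable _), lintegral_map (measurable_of_countable _) hmeas]
    rfl
  have hres : P = P.restrict (⋃ i, winEvent X n i) :=
    (Measure.restrict_eq_self_of_ae_mem (hX.ae_win hF hx₀ n)).symm
  conv_lhs => rw [hres]
  rw [lintegral_iUnion (measurableSet_winEvent hX.measurable n) (pairwise_disjoint_winEvent X n),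
    tsum_fintype, lintegral_finsetSum]
  · exact Finset.sum_congr rfl fun i _ => key i
  · intro i _
    exact (measurable_of_countable fun h : Fin (n + 1) → Fin A → ℕ =>
      ENNReal.ofReal (F (h (Fin.last n) i) / ∑ j, F (h (Fin.last n) j)) *
        g h (h (Fin.last n) + Pi.single i 1)).comp hmeas

end

section Noise

/-- The law of an i.i.d. sequence of standard exponential variables. -/
noncomputable def expNoise : Measure (ℕ → ℝ) := Measure.infinitePi fun _ => expMeasure 1

instance isProbabilityMeasure_expMeasure_one : IsProbabilityMeasure (expMeasure 1) :=
  isProbabilityMeasure_expMeasure one_pos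

instance isProbabilityMeasure_expNoise : IsProbabilityMeasure expNoise := by
  unfold expNoise
  infer_instance

theorem lintegral_exp_mul_expMeasure {c : ℝ} (hc : c < 1) :
    ∫⁻ y, ENNReal.ofReal (Real.exp (c * y)) ∂(expMeasure 1) = ENNReal.ofReal (1 / (1 - c)) := by
  have hc' : 0 < 1 - c := by linarith
  have hd : expMeasure 1 = volume.withDensity (exponentialPDF 1) := rfl
  have hm : ∀ r, Measurable (exponentialPDF r) := fun r =>
    (measurable_exponentialPDFReal r).ennreal_ofReal
  rw [hd, lintegral_withDensity_eq_lintegral_mul _ (hm 1) (by fun_prop)]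
  have h : ∀ y, (exponentialPDF 1 * fun y => ENNReal.ofReal (Real.exp (c * y))) y =
      ENNReal.ofReal (1 / (1 - c)) * exponentialPDF (1 - c) y := by
    intro y
    simp only [Pi.mul_apply, exponentialPDF_eq]
    rw [← ENNReal.ofReal_mul (by split_ifs <;> positivity), ← ENNReal.ofReal_mul (by positivity)]
    congr 1
    split_ifs
    · rw [← mul_assoc, one_div_mul_cancel hc'.ne', mul_assoc, ← Real.exp_add]
      ring_nf
    · ring
  simp_rw [h]
  rw [lintegral_const_mul _ (hm _), lintegral_exponentialPDF_eq_one hc', mul_one]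

/-- The noise variables used before time `n`. -/
def noiseUpTo (n : ℕ) (y : ℕ → ℝ) : Fin n → ℝ := fun m => y m

theorem measurable_noiseUpTo (n : ℕ) : Measurable (noiseUpTo n) :=
  measurable_pi_lambda _ fun _ => measurable_pi_apply _

theorem indepFun_noiseUpTo (n : ℕ) : IndepFun (noiseUpTo n) (fun y => y n) expNoise := by
  have h : iIndepFun (fun (i : ℕ) (y : ℕ → ℝ) => y i) expNoise :=
    iIndepFun_infinitePi (P := fun _ => expMeasure 1) (X := fun _ x => x) fun _ => measurable_id
  have h1 := h.indepFun_finset (Finset.range n) {n} (by simp) fun i => measurable_pi_apply i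
  have hφ : Measurable fun (v : Finset.range n → ℝ) (m : Fin n) => v ⟨m, by simp⟩ :=
    measurable_pi_lambda _ fun _ => measurable_pi_apply _
  have hψ : Measurable fun v : ({n} : Finset ℕ) → ℝ => v ⟨n, by simp⟩ := measurable_pi_apply _
  exact h1.comp hφ hψ

theorem lintegral_noise_step (n : ℕ) {g : (Fin n → ℝ) → ℝ≥0∞} (hg : Measurable g) {c : ℝ}
    (hc : c < 1) :
    ∫⁻ y, g (noiseUpTo n y) * ENNReal.ofReal (Real.exp (c * y n)) ∂expNoise =
      (∫⁻ y, g (noiseUpTo n y) ∂expNoise) * ENNReal.ofReal (1 / (1 - c)) := by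
  have hm : Measurable fun y : ℝ => ENNReal.ofReal (Real.exp (c * y)) := by fun_prop
  have h1 := lintegral_mul_eq_lintegral_mul_lintegral_of_indepFun''
    (hg.comp (measurable_noiseUpTo n)).aemeasurable (hm.comp (measurable_pi_apply n)).aemeasurable
    ((indepFun_noiseUpTo n).comp hg hm)
  have h2 : ∫⁻ y, ENNReal.ofReal (Real.exp (c * y n)) ∂expNoise = ENNReal.ofReal (1 / (1 - c)) := by
    rw [← lintegral_exp_mul_expMeasure hc,
      ← Measure.infinitePi_map_eval (fun _ : ℕ => expMeasure 1) n,
      lintegral_map hm (measurable_pi_apply n)]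
    rfl
  rw [← h2]
  exact h1

end Noise

end

/-! ### The exponential martingale -/

section

open scoped ENNReal

section

variable {A : ℕ}

/-- The total rate at which agents in state `z` grow. -/
noncomputable def totalRate (F : ℕ → ℝ) (z : Fin A → ℕ) : ℝ := ∑ j, F (z j)

/-- The product `∏ i, ∏_{x₀ i ≤ k < z i} (1 - s i / F k)`, the reciprocal of the joint moment
generating function of the exponential holding times of all agents up to the state `z`. -/
noncomputable def mgfInv (F : ℕ → ℝ) (x₀ : Fin A → ℕ) (s : Fin A → ℝ) (z : Fin A → ℕ) : ℝ :=
  ∏ i, ∏ k ∈ Finset.Ico (x₀ i) (z i), (1 - s i / F k)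

/-- The time of the `n`-th jump for the trajectory `h` if the holding time in state `h m` is `v m`
divided by the total rate. -/
noncomputable def pathTime (F : ℕ → ℝ) {n : ℕ} (h : Fin (n + 1) → Fin A → ℕ) (v : Fin n → ℝ) : ℝ :=
  ∑ m, v m / totalRate F (h m.castSucc)

variable {F : ℕ → ℝ} {x₀ : Fin A → ℕ} {s : Fin A → ℝ}

theorem mgfInv_pos (hF : ∀ k, 1 ≤ k → 0 < F k) (hx₀ : ∀ i, 1 ≤ x₀ i)
    (hs : ∀ i k, x₀ i ≤ k → |s i| < F k) (z : Fin A → ℕ) : 0 < mgfInv F x₀ s z := by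
  refine Finset.prod_pos fun i _ => Finset.prod_pos fun k hk => ?_
  have hk := (Finset.mem_Ico.1 hk).1
  rw [sub_pos, div_lt_one (hF k ((hx₀ i).trans hk))]
  exact (le_abs_self _).trans_lt (hs i k hk)

theorem mgfInv_add_single {z : Fin A → ℕ} (hz : ∀ i, x₀ i ≤ z i) (i : Fin A) :
    mgfInv F x₀ s (z + Pi.single i 1) = mgfInv F x₀ s z * (1 - s i / F (z i)) := by
  unfold mgfInv
  rw [← Finset.mul_prod_erase _ _ (Finset.mem_univ i),
    ← Finset.mul_prod_erase (a := i) _ (fun i => ∏ k ∈ Finset.Ico (x₀ i) (z i), (1 - s i / F k))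
      (Finset.mem_univ i)]
  have h1 : ∏ j ∈ Finset.univ.erase i,
      ∏ k ∈ Finset.Ico (x₀ j) ((z + Pi.single i 1 : Fin A → ℕ) j), (1 - s j / F k) =
      ∏ j ∈ Finset.univ.erase i, ∏ k ∈ Finset.Ico (x₀ j) (z j), (1 - s j / F k) := by
    refine Finset.prod_congr rfl fun j hj => ?_
    rw [Pi.add_apply, Pi.single_eq_of_ne (Finset.ne_of_mem_erase hj), add_zero]
  rw [h1, Pi.add_apply, Pi.single_eq_same, Finset.prod_Ico_succ_top (hz i)]
  ring

theorem sum_lt_totalRate [Nonempty (Fin A)] (hs : ∀ i k, x₀ i ≤ k → |s i| < F k)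
    {z : Fin A → ℕ} (hz : ∀ i, x₀ i ≤ z i) : ∑ i, s i < totalRate F z :=
  Finset.sum_lt_sum_of_nonempty Finset.univ_nonempty fun i _ =>
    (le_abs_self _).trans_lt (hs i _ (hz i))

theorem totalRate_pos [Nonempty (Fin A)] (hF : ∀ k, 1 ≤ k → 0 < F k) (hx₀ : ∀ i, 1 ≤ x₀ i)
    {z : Fin A → ℕ} (hz : ∀ i, x₀ i ≤ z i) : 0 < totalRate F z :=
  Finset.sum_pos (fun i _ => hF _ ((hx₀ i).trans (hz i))) Finset.univ_nonempty

/-- The one-step mean of `mgfInv` compensates the moment generating function of the holding time. -/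
theorem sum_win_prob_mul_mgfInv [Nonempty (Fin A)] (hF : ∀ k, 1 ≤ k → 0 < F k)
    (hx₀ : ∀ i, 1 ≤ x₀ i) (hs : ∀ i k, x₀ i ≤ k → |s i| < F k)
    {z : Fin A → ℕ} (hz : ∀ i, x₀ i ≤ z i) :
    ∑ i, ENNReal.ofReal (F (z i) / ∑ j, F (z j)) *
        ENNReal.ofReal (mgfInv F x₀ s (z + Pi.single i 1)) =
      ENNReal.ofReal (mgfInv F x₀ s z) *
        ENNReal.ofReal (1 - (∑ i, s i) / totalRate F z) := by
  have hS := totalRate_pos hF hx₀ hz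
  have hFz : ∀ i, 0 < F (z i) := fun i => hF _ ((hx₀ i).trans (hz i))
  have hp : ∀ i, 0 ≤ F (z i) / ∑ j, F (z j) := fun i => div_nonneg (hFz i).le hS.le
  simp_rw [← ENNReal.ofReal_mul (hp _)]
  rw [← ENNReal.ofReal_sum_of_nonneg fun i _ => mul_nonneg (hp i) (mgfInv_pos hF hx₀ hs _).le,
    ← ENNReal.ofReal_mul (mgfInv_pos hF hx₀ hs _).le]
  congr 1
  have h1 : ∀ i, F (z i) / (∑ j, F (z j)) * mgfInv F x₀ s (z + Pi.single i 1) =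
      mgfInv F x₀ s z / totalRate F z * (F (z i) - s i) := by
    intro i
    rw [mgfInv_add_single hz, totalRate]
    have := (hFz i).ne'
    have hS' : (∑ j, F (z j)) ≠ 0 := hS.ne'
    field_simp
  simp_rw [h1]
  rw [← Finset.mul_sum, Finset.sum_sub_distrib]
  have hS' := hS.ne'
  change _ / _ * (totalRate F z - _) = _
  field_simp

theorem measurable_pathTime (F : ℕ → ℝ) (n : ℕ) :
    Measurable fun p : (Fin (n + 1) → Fin A → ℕ) × (Fin n → ℝ) => pathTime F p.1 p.2 := by
  unfold pathTime
  refine Finset.measurable_sum _ fun m _ => ?_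
  have h1 : Measurable fun h : Fin (n + 1) → Fin A → ℕ => totalRate F (h m.castSucc) :=
    measurable_of_countable _
  exact ((measurable_pi_apply m).comp measurable_snd).div (h1.comp measurable_fst)

variable {Ω : Type u} [MeasurableSpace Ω] {P : Measure Ω} {X : ℕ → Ω → Fin A → ℕ}

/-- The trajectory up to time `n` together with the noise variables used for it. -/
def historyUpTo (X : ℕ → Ω → Fin A → ℕ) (n : ℕ) (p : Ω × (ℕ → ℝ)) :
    (Fin (n + 1) → Fin A → ℕ) × (Fin n → ℝ) :=
  (pathUpTo X n p.1, noiseUpTo n p.2)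

theorem measurable_historyUpTo (hX : ∀ n, Measurable (X n)) (n : ℕ) :
    Measurable (historyUpTo X n) :=
  ((measurable_pathUpTo hX n).comp measurable_fst).prodMk
    ((measurable_noiseUpTo n).comp measurable_snd)

/-- The time of the `n`-th jump when the urn is run in continuous time, with holding times built
from the noise. -/
noncomputable def jumpTime (F : ℕ → ℝ) (X : ℕ → Ω → Fin A → ℕ) (n : ℕ) (p : Ω × (ℕ → ℝ)) : ℝ :=
  ∑ m ∈ Finset.range n, p.2 m / totalRate F (X m p.1)

omit [MeasurableSpace Ω] in
theorem jumpTime_eq_pathTime (n : ℕ) (p : Ω × (ℕ → ℝ)) :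
    jumpTime F X n p = pathTime F (historyUpTo X n p).1 (historyUpTo X n p).2 := by
  rw [jumpTime, Finset.sum_range]
  rfl

/-- The joint exponential martingale of the time shifts of all agents. -/
noncomputable def expMart (F : ℕ → ℝ) (x₀ : Fin A → ℕ) (s : Fin A → ℝ) (X : ℕ → Ω → Fin A → ℕ)
    (n : ℕ) (p : Ω × (ℕ → ℝ)) : ℝ :=
  Real.exp ((∑ i, s i) * jumpTime F X n p) * mgfInv F x₀ s (X n p.1)

theorem measurable_jumpTime (hX : ∀ n, Measurable (X n)) (n : ℕ) :
    Measurable (jumpTime F X n) := by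
  have : jumpTime F X n = (fun q => pathTime F q.1 q.2) ∘ historyUpTo X n :=
    funext fun p => jumpTime_eq_pathTime n p
  rw [this]
  exact (measurable_pathTime F n).comp (measurable_historyUpTo hX n)

theorem measurable_expMart (hX : ∀ n, Measurable (X n)) (n : ℕ) :
    Measurable (expMart F x₀ s X n) := by
  refine ((measurable_jumpTime hX n).const_mul _).exp.mul ?_
  exact (measurable_of_countable (mgfInv F x₀ s)).comp ((hX n).comp measurable_fst)

omit [MeasurableSpace Ω] in
theorem expMart_nonneg (hF : ∀ k, 1 ≤ k → 0 < F k) (hx₀ : ∀ i, 1 ≤ x₀ i)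
    (hs : ∀ i k, x₀ i ≤ k → |s i| < F k) (n : ℕ) (p : Ω × (ℕ → ℝ)) :
    0 ≤ expMart F x₀ s X n p :=
  mul_nonneg (Real.exp_nonneg _) (mgfInv_pos hF hx₀ hs _).le

/-- The martingale property of `expMart`, tested against functions of the history. -/
theorem lintegral_history_mul_expMart_succ (hX : IsPolyaUrn (fun _ => F) x₀ P X)
    [IsProbabilityMeasure P] [Nonempty (Fin A)] (hF : ∀ k, 1 ≤ k → 0 < F k)
    (hx₀ : ∀ i, 1 ≤ x₀ i) (hs : ∀ i k, x₀ i ≤ k → |s i| < F k) (n : ℕ)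
    {G : (Fin (n + 1) → Fin A → ℕ) × (Fin n → ℝ) → ℝ≥0∞} (hG : Measurable G) :
    ∫⁻ p, G (historyUpTo X n p) * ENNReal.ofReal (expMart F x₀ s X (n + 1) p) ∂(P.prod expNoise) =
      ∫⁻ p, G (historyUpTo X n p) * ENNReal.ofReal (expMart F x₀ s X n p) ∂(P.prod expNoise) := by
  set σ := ∑ i, s i
  set ρ := mgfInv F x₀ s
  -- `K` collects all factors that depend on the history only
  set K : (Fin (n + 1) → Fin A → ℕ) × (Fin n → ℝ) → ℝ≥0∞ := fun q =>
    G q * ENNReal.ofReal (Real.exp (σ * pathTime F q.1 q.2)) with hK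
  have hKm : Measurable K := hG.mul ((measurable_pathTime F n).const_mul _).exp.ennreal_ofReal
  set c : (Fin A → ℕ) → ℝ := fun z => σ / totalRate F z with hc
  have hXm := hX.measurable
  have hKX : Measurable fun p : Ω × (ℕ → ℝ) => K (historyUpTo X n p) :=
    hKm.comp (measurable_historyUpTo hXm n)
  have hcm : Measurable fun p : Ω × (ℕ → ℝ) =>
      ENNReal.ofReal (Real.exp (c (X n p.1) * p.2 n)) :=
    ((((measurable_of_countable c).comp ((hXm n).comp measurable_fst)).mul
      ((measurable_pi_apply n).comp measurable_snd)).exp).ennreal_ofReal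
  have hρm : ∀ m, Measurable fun p : Ω × (ℕ → ℝ) => ENNReal.ofReal (ρ (X m p.1)) := fun m =>
    ((measurable_of_countable fun z => ENNReal.ofReal (ρ z)).comp (hXm m)).comp measurable_fst
  have hdm : Measurable fun p : Ω × (ℕ → ℝ) => ENNReal.ofReal (1 - c (X n p.1)) :=
    ((measurable_of_countable fun z => ENNReal.ofReal (1 - c z)).comp (hXm n)).comp measurable_fst
  have hleft : ∀ p, G (historyUpTo X n p) * ENNReal.ofReal (expMart F x₀ s X (n + 1) p) =
      K (historyUpTo X n p) * ENNReal.ofReal (Real.exp (c (X n p.1) * p.2 n)) *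
        ENNReal.ofReal (ρ (X (n + 1) p.1)) := by
    intro p
    rw [expMart, jumpTime, Finset.sum_range_succ, ← jumpTime, mul_add, Real.exp_add,
      ENNReal.ofReal_mul (by positivity), ENNReal.ofReal_mul (by positivity), hK]
    simp only [← jumpTime_eq_pathTime]
    rw [show σ * (p.2 n / totalRate F (X n p.1)) = c (X n p.1) * p.2 n by simp only [hc]; ring]
    simp only [mul_assoc]
    rfl
  have hright : ∀ p, G (historyUpTo X n p) * ENNReal.ofReal (expMart F x₀ s X n p) =
      K (historyUpTo X n p) * ENNReal.ofReal (ρ (X n p.1)) := by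
    intro p
    rw [expMart, ENNReal.ofReal_mul (by positivity), hK]
    simp only [← jumpTime_eq_pathTime, mul_assoc]
    rfl
  simp_rw [hleft, hright]
  -- first average over the next jump, for fixed noise
  have step1 : ∀ y : ℕ → ℝ,
      ∫⁻ ω, K (historyUpTo X n (ω, y)) * ENNReal.ofReal (Real.exp (c (X n ω) * y n)) *
        ENNReal.ofReal (ρ (X (n + 1) ω)) ∂P =
      ∫⁻ ω, K (historyUpTo X n (ω, y)) * ENNReal.ofReal (Real.exp (c (X n ω) * y n)) *
        (ENNReal.ofReal (ρ (X n ω)) * ENNReal.ofReal (1 - c (X n ω))) ∂P := by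
    intro y
    have h := hX.lintegral_step hF hx₀ n fun h z => K (h, noiseUpTo n y) *
      ENNReal.ofReal (Real.exp (c (h (Fin.last n)) * y n)) * ENNReal.ofReal (ρ z)
    refine Eq.trans h (lintegral_congr_ae ?_)
    filter_upwards [hX.ae_le hF hx₀ n] with ω hω
    rw [← sum_win_prob_mul_mgfInv hF hx₀ hs hω, Finset.mul_sum]
    refine Finset.sum_congr rfl fun i _ => ?_
    rw [mul_left_comm]
    rfl
  -- then average over the next holding time, for fixed trajectory
  have step2 : ∀ᵐ ω ∂P,
      ∫⁻ y, K (historyUpTo X n (ω, y)) * ENNReal.ofReal (Real.exp (c (X n ω) * y n)) *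
        (ENNReal.ofReal (ρ (X n ω)) * ENNReal.ofReal (1 - c (X n ω))) ∂expNoise =
      ∫⁻ y, K (historyUpTo X n (ω, y)) * ENNReal.ofReal (ρ (X n ω)) ∂expNoise := by
    filter_upwards [hX.ae_le hF hx₀ n] with ω hω
    have hc1 : c (X n ω) < 1 :=
      (div_lt_one (totalRate_pos hF hx₀ hω)).2 (sum_lt_totalRate hs hω)
    have hg : Measurable fun v : Fin n → ℝ => K (pathUpTo X n ω, v) :=
      hKm.comp measurable_prodMk_left
    have h := lintegral_noise_step n hg hc1
    have hgy : Measurable fun y => K (historyUpTo X n (ω, y)) :=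
      hg.comp (measurable_noiseUpTo n)
    have hgy' : Measurable fun y : ℕ → ℝ => K (historyUpTo X n (ω, y)) *
        ENNReal.ofReal (Real.exp (c (X n ω) * y n)) :=
      hgy.mul (by fun_prop)
    rw [lintegral_mul_const _ hgy', lintegral_mul_const _ hgy]
    refine (congrArg (· * _) h).trans ?_
    rw [mul_assoc, mul_left_comm (ENNReal.ofReal (1 / _)), ← ENNReal.ofReal_mul
      (one_div_nonneg.2 (by linarith)), one_div_mul_cancel (by linarith), ENNReal.ofReal_one,
      mul_one]
    rfl
  have m1 : Measurable fun p : Ω × (ℕ → ℝ) => K (historyUpTo X n p) *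
      ENNReal.ofReal (Real.exp (c (X n p.1) * p.2 n)) * ENNReal.ofReal (ρ (X (n + 1) p.1)) :=
    (hKX.mul hcm).mul (hρm (n + 1))
  have m2 : Measurable fun p : Ω × (ℕ → ℝ) => K (historyUpTo X n p) *
      ENNReal.ofReal (Real.exp (c (X n p.1) * p.2 n)) *
        (ENNReal.ofReal (ρ (X n p.1)) * ENNReal.ofReal (1 - c (X n p.1))) :=
    (hKX.mul hcm).mul ((hρm n).mul hdm)
  have m3 : Measurable fun p : Ω × (ℕ → ℝ) =>
      K (historyUpTo X n p) * ENNReal.ofReal (ρ (X n p.1)) := hKX.mul (hρm n)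
  rw [lintegral_prod_symm' _ m1]
  simp only [step1]
  rw [← lintegral_prod_symm' _ m2, lintegral_prod _ m2.aemeasurable,
    lintegral_prod _ m3.aemeasurable]
  exact lintegral_congr_ae step2

theorem lintegral_expMart (hX : IsPolyaUrn (fun _ => F) x₀ P X)
    [IsProbabilityMeasure P] [Nonempty (Fin A)] (hF : ∀ k, 1 ≤ k → 0 < F k)
    (hx₀ : ∀ i, 1 ≤ x₀ i) (hs : ∀ i k, x₀ i ≤ k → |s i| < F k) (n : ℕ) :
    ∫⁻ p, ENNReal.ofReal (expMart F x₀ s X n p) ∂(P.prod expNoise) = 1 := by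
  induction n with
  | zero =>
    rw [lintegral_congr_ae (g := fun _ => 1), lintegral_one, measure_univ]
    have h := Measure.quasiMeasurePreserving_fst (μ := P) (ν := expNoise)
    filter_upwards [h.ae hX.init] with p hp
    simp [expMart, jumpTime, mgfInv, hp]
  | succ n ih =>
    have h := lintegral_history_mul_expMart_succ hX hF hx₀ hs n (G := fun _ => 1) measurable_const
    simp only [one_mul] at h
    rw [h, ih]

theorem integrable_expMart (hX : IsPolyaUrn (fun _ => F) x₀ P X)
    [IsProbabilityMeasure P] [Nonempty (Fin A)] (hF : ∀ k, 1 ≤ k → 0 < F k)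
    (hx₀ : ∀ i, 1 ≤ x₀ i) (hs : ∀ i k, x₀ i ≤ k → |s i| < F k) (n : ℕ) :
    Integrable (expMart F x₀ s X n) (P.prod expNoise) := by
  refine ⟨(measurable_expMart hX.measurable n).aestronglyMeasurable, ?_⟩
  rw [hasFiniteIntegral_iff_ofReal (Eventually.of_forall (expMart_nonneg hF hx₀ hs n)),
    lintegral_expMart hX hF hx₀ hs n]
  exact ENNReal.one_lt_top

/-- The filtration generated by the urn and the holding times. -/
def historyFiltration (hX : ∀ n, Measurable (X n)) :
    Filtration ℕ (inferInstance : MeasurableSpace (Ω × (ℕ → ℝ))) where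
  seq n := MeasurableSpace.comap (historyUpTo X n) inferInstance
  mono' := by
    refine monotone_nat_of_le_succ fun n => ?_
    have h : historyUpTo X n = (fun q : (Fin (n + 2) → Fin A → ℕ) × (Fin (n + 1) → ℝ) =>
        ((fun m : Fin (n + 1) => q.1 m.castSucc), fun m : Fin n => q.2 m.castSucc)) ∘
          historyUpTo X (n + 1) := rfl
    rw [h, ← MeasurableSpace.comap_comp]
    refine MeasurableSpace.comap_mono (Measurable.comap_le ?_)
    exact (measurable_pi_lambda _ fun m => (measurable_pi_apply _).comp measurable_fst).prodMk
      (measurable_pi_lambda _ fun m => (measurable_pi_apply _).comp measurable_snd)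
  le' n := (measurable_historyUpTo hX n).comap_le

theorem martingale_expMart (hX : IsPolyaUrn (fun _ => F) x₀ P X)
    [IsProbabilityMeasure P] [Nonempty (Fin A)] (hF : ∀ k, 1 ≤ k → 0 < F k)
    (hx₀ : ∀ i, 1 ≤ x₀ i) (hs : ∀ i k, x₀ i ≤ k → |s i| < F k) :
    Martingale (expMart F x₀ s X) (historyFiltration hX.measurable) (P.prod expNoise) := by
  refine martingale_of_setIntegral_eq_succ (fun n => ?_)
    (integrable_expMart hX hF hx₀ hs) (fun n B hB => ?_)
  · refine Measurable.stronglyMeasurable ?_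
    have h : expMart F x₀ s X n = (fun q : (Fin (n + 1) → Fin A → ℕ) × (Fin n → ℝ) =>
        Real.exp ((∑ i, s i) * pathTime F q.1 q.2) * mgfInv F x₀ s (q.1 (Fin.last n))) ∘
          historyUpTo X n := by
      funext p
      simp only [expMart, jumpTime_eq_pathTime, Function.comp_apply]
      rfl
    rw [h]
    refine Measurable.comp ?_ (comap_measurable (historyUpTo X n))
    refine ((measurable_pathTime F n).const_mul _).exp.mul ?_
    exact (measurable_of_countable fun h : Fin (n + 1) → Fin A → ℕ =>
      mgfInv F x₀ s (h (Fin.last n))).comp measurable_fst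
  · obtain ⟨B', hB', rfl⟩ := hB
    have hm := measurable_historyUpTo hX.measurable n hB'
    have h0 := expMart_nonneg (X := X) hF hx₀ hs
    have hmeas := measurable_expMart (F := F) (x₀ := x₀) (s := s) hX.measurable
    rw [integral_eq_lintegral_of_nonneg_ae (Eventually.of_forall (h0 n))
        (hmeas n).aestronglyMeasurable,
      integral_eq_lintegral_of_nonneg_ae (Eventually.of_forall (h0 (n + 1)))
        (hmeas (n + 1)).aestronglyMeasurable,
      ← lintegral_indicator hm, ← lintegral_indicator hm]
    have h := lintegral_history_mul_expMart_succ hX hF hx₀ hs n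
      (G := B'.indicator fun _ => 1) (measurable_const.indicator hB')
    congr 1
    convert h.symm using 3 with p p
    · by_cases hp : historyUpTo X n p ∈ B' <;> simp [hp]
    · by_cases hp : historyUpTo X n p ∈ B' <;> simp [hp]

end

end

/-! ### Convergence of the time shifts and their joint law -/

section

open scoped ENNReal

section

variable {A : ℕ} {F : ℕ → ℝ} {x₀ : Fin A → ℕ} {Ω : Type u} {X : ℕ → Ω → Fin A → ℕ}

/-- The difference between the real time of the `n`-th jump and the expected time in which agent `i`
reaches its current size. -/
noncomputable def timeShift (F : ℕ → ℝ) (x₀ : Fin A → ℕ) (X : ℕ → Ω → Fin A → ℕ) (i : Fin A) (n : ℕ)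
    (p : Ω × (ℕ → ℝ)) : ℝ :=
  jumpTime F X n p - ∑ k ∈ Finset.Ico (x₀ i) (X n p.1 i), 1 / F k

theorem exp_mul_timeShift_mul_prod (s : ℝ) (i : Fin A) (n : ℕ) (p : Ω × (ℕ → ℝ)) :
    Real.exp (s * timeShift F x₀ X i n p) *
        ∏ k ∈ Finset.Ico (x₀ i) (X n p.1 i), (1 - s / F k) * Real.exp (s / F k) =
      Real.exp (s * jumpTime F X n p) * ∏ k ∈ Finset.Ico (x₀ i) (X n p.1 i), (1 - s / F k) := by
  rw [Finset.prod_mul_distrib, mul_left_comm, mul_comm, ← Real.exp_sum, ← Real.exp_add, timeShift]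
  congr 2
  rw [mul_sub, Finset.mul_sum]
  simp [div_eq_mul_inv]

/-- `expMart` splits over the agents into the exponentials of the time shifts and the compensated
products, which converge to positive limits. -/
theorem expMart_eq_prod (s : Fin A → ℝ) (n : ℕ) (p : Ω × (ℕ → ℝ)) :
    expMart F x₀ s X n p = ∏ i, (Real.exp (s i * timeShift F x₀ X i n p) *
        ∏ k ∈ Finset.Ico (x₀ i) (X n p.1 i), (1 - s i / F k) * Real.exp (s i / F k)) := by
  simp_rw [exp_mul_timeShift_mul_prod]
  rw [Finset.prod_mul_distrib, ← Real.exp_sum, ← Finset.sum_mul]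
  rfl

theorem expMart_single (s : ℝ) (i : Fin A) (n : ℕ) (p : Ω × (ℕ → ℝ)) :
    expMart F x₀ (Pi.single i s) X n p = Real.exp (s * timeShift F x₀ X i n p) *
        ∏ k ∈ Finset.Ico (x₀ i) (X n p.1 i), (1 - s / F k) * Real.exp (s / F k) := by
  rw [expMart_eq_prod, Finset.prod_eq_single i]
  · simp
  · intro j _ hj
    simp [Pi.single_eq_of_ne hj]
  · simp

theorem prod_Ico_le_one {F : ℕ → ℝ} {x : ℕ} {R s : ℝ} (hR : 0 < R) (hle : ∀ k, R ≤ F (x + k))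
    (hs : |s| < R) (m : ℕ) : ∏ k ∈ Finset.Ico x m, (1 - s / F k) * Real.exp (s / F k) ≤ 1 := by
  simpa using antitone_prod_Ico hR hle hs (Nat.zero_le m)

/-- A power of order `q > 1` of `expMart` is dominated by `expMart` with the exponents multiplied by
`q`. -/
theorem expMart_rpow_le (hsum : ∀ i, Summable (fun k : ℕ => 1 / F (x₀ i + k) ^ 2))
    {R : Fin A → ℝ} (hR : ∀ i, 0 < R i) (hle : ∀ i k, R i ≤ F (x₀ i + k)) {s : Fin A → ℝ}
    {q : ℝ} (hq : 1 < q) (hs : ∀ i, |s i| < R i) (hqs : ∀ i, |q * s i| < R i) (n : ℕ)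
    (p : Ω × (ℕ → ℝ)) :
    expMart F x₀ s X n p ^ q ≤
      Real.exp (∑ i, shiftCgf F (x₀ i) (q * s i)) *
        expMart F x₀ (fun i => q * s i) X n p := by
  have hlow := fun i => exp_neg_shiftCgf_le_prod_Ico (hsum i) (hR i) (hle i) (hqs i) (X n p.1 i)
  have hpos := fun i => (Real.exp_pos _).trans_le
    (exp_neg_shiftCgf_le_prod_Ico (hsum i) (hR i) (hle i) (hs i) (X n p.1 i))
  rw [expMart_eq_prod, expMart_eq_prod, Real.exp_sum, ← Finset.prod_mul_distrib,
    ← Real.finsetProd_rpow _ _ fun i _ => (mul_pos (Real.exp_pos _) (hpos i)).le]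
  refine Finset.prod_le_prod
    (fun i _ => Real.rpow_nonneg (mul_pos (Real.exp_pos _) (hpos i)).le _) fun i _ => ?_
  calc _ ≤ Real.exp (s i * timeShift F x₀ X i n p) ^ q := by
        refine Real.rpow_le_rpow (mul_pos (Real.exp_pos _) (hpos i)).le ?_ (by linarith)
        exact mul_le_of_le_one_right (Real.exp_nonneg _) (prod_Ico_le_one (hR i) (hle i) (hs i) _)
    _ = Real.exp (q * s i * timeShift F x₀ X i n p) := by
        rw [← Real.exp_mul]
        ring_nf
    _ = Real.exp (shiftCgf F (x₀ i) (q * s i)) * (Real.exp (q * s i * timeShift F x₀ X i n p) *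
          Real.exp (-shiftCgf F (x₀ i) (q * s i))) := by
        rw [mul_left_comm, ← Real.exp_add]
        simp
    _ ≤ _ := by
        gcongr
        exact hlow i

variable [MeasurableSpace Ω] {P : Measure Ω}

theorem measurable_timeShift (hX : ∀ n, Measurable (X n)) (i : Fin A) (n : ℕ) :
    Measurable (timeShift F x₀ X i n) := by
  refine (measurable_jumpTime hX n).sub ?_
  exact (measurable_of_countable fun z : Fin A → ℕ =>
    ∑ k ∈ Finset.Ico (x₀ i) (z i), 1 / F k).comp ((hX n).comp measurable_fst)

theorem ae_tendsto_expMart (hX : IsPolyaUrn (fun _ => F) x₀ P X)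
    [IsProbabilityMeasure P] [Nonempty (Fin A)] (hF : ∀ k, 1 ≤ k → 0 < F k)
    (hx₀ : ∀ i, 1 ≤ x₀ i) {s : Fin A → ℝ} (hs : ∀ i k, x₀ i ≤ k → |s i| < F k) :
    ∀ᵐ p ∂(P.prod expNoise), ∃ c, Tendsto (fun n => expMart F x₀ s X n p) atTop (𝓝 c) := by
  refine (martingale_expMart hX hF hx₀ hs).submartingale.exists_ae_tendsto_of_bdd (R := 1)
    fun n => ?_
  rw [eLpNorm_one_eq_lintegral_enorm]
  refine le_of_eq ?_
  rw [ENNReal.coe_one, ← lintegral_expMart hX hF hx₀ hs n]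
  refine lintegral_congr fun p => ?_
  rw [← ofReal_norm, Real.norm_of_nonneg (expMart_nonneg hF hx₀ hs n p)]

theorem ae_trajectory (hX : IsPolyaUrn (fun _ => F) x₀ P X) [IsProbabilityMeasure P]
    [Nonempty (Fin A)] (hF : ∀ k, 1 ≤ k → 0 < F k) (hx₀ : ∀ i, 1 ≤ x₀ i) :
    ∀ᵐ p ∂(P.prod expNoise),
      X 0 p.1 = x₀ ∧ ∀ n, ∃ i, X (n + 1) p.1 = X n p.1 + Pi.single i 1 := by
  refine (Measure.quasiMeasurePreserving_fst (μ := P) (ν := expNoise)).ae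
    (p := fun ω => X 0 ω = x₀ ∧ ∀ n, ∃ i, X (n + 1) ω = X n ω + Pi.single i 1) ?_
  filter_upwards [hX.init, ae_all_iff.2 fun n => hX.ae_win hF hx₀ n] with ω h0 hω
  exact ⟨h0, fun n => Set.mem_iUnion.1 (hω n)⟩

theorem monotone_of_win {z : ℕ → Fin A → ℕ} (h : ∀ n, ∃ i, z (n + 1) = z n + Pi.single i 1)
    (i : Fin A) : Monotone fun n => z n i := by
  refine monotone_nat_of_le_succ fun n => ?_
  obtain ⟨j, hj⟩ := h n
  rw [hj]
  exact Nat.le_add_right _ _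

theorem tendsto_of_tendsto_exp {M : ℕ → ℝ} {ε a b : ℝ} (hε : 0 < ε)
    (ha : Tendsto (fun n => Real.exp (ε * M n)) atTop (𝓝 a))
    (hb : Tendsto (fun n => Real.exp (-ε * M n)) atTop (𝓝 b)) :
    ∃ c, Tendsto M atTop (𝓝 c) := by
  have hab : a * b = 1 := by
    refine tendsto_nhds_unique (ha.mul hb) ?_
    simp [← Real.exp_add]
  have ha0 : a ≠ 0 := left_ne_zero_of_mul_eq_one hab
  refine ⟨ε⁻¹ * Real.log a, ((ha.log ha0).const_mul ε⁻¹).congr fun n => ?_⟩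
  rw [Real.log_exp]
  field_simp

/-- The time shifts converge almost surely: the martingales with exponents `ε` and `-ε` converge, so
that neither `exp (ε M)` nor its inverse can blow up. -/
theorem ae_exists_tendsto_timeShift (hX : IsPolyaUrn (fun _ => F) x₀ P X)
    [IsProbabilityMeasure P] [Nonempty (Fin A)] (hF : ∀ k, 1 ≤ k → 0 < F k)
    (hx₀ : ∀ i, 1 ≤ x₀ i) (hsum : ∀ i, Summable (fun k : ℕ => 1 / F (x₀ i + k) ^ 2))
    {R : Fin A → ℝ} (hR : ∀ i, 0 < R i) (hle : ∀ i k, R i ≤ F (x₀ i + k)) (i : Fin A) :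
    ∀ᵐ p ∂(P.prod expNoise), ∃ c, Tendsto (fun n => timeShift F x₀ X i n p) atTop (𝓝 c) := by
  have hhalf : |R i / 2| < R i := by rw [abs_of_pos (half_pos (hR i))]; exact half_lt_self (hR i)
  have hhalf' : |-(R i / 2)| < R i := by rwa [abs_neg]
  have hs : ∀ r : ℝ, |r| < R i → ∀ j k, x₀ j ≤ k → |(Pi.single i r : Fin A → ℝ) j| < F k := by
    intro r hr j k hk
    rcases eq_or_ne j i with rfl | hj
    · obtain ⟨m, rfl⟩ := Nat.exists_eq_add_of_le hk
      rw [Pi.single_eq_same]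
      exact hr.trans_le (hle j m)
    · rw [Pi.single_eq_of_ne hj, abs_zero]
      exact hF k ((hx₀ j).trans hk)
  filter_upwards [ae_tendsto_expMart hX hF hx₀ (hs _ hhalf),
    ae_tendsto_expMart hX hF hx₀ (hs _ hhalf'), ae_trajectory hX hF hx₀] with p h1 h2 hp
  have key : ∀ r : ℝ, |r| < R i →
      (∃ c, Tendsto (fun n => expMart F x₀ (Pi.single i r) X n p) atTop (𝓝 c)) →
      ∃ c, Tendsto (fun n => Real.exp (r * timeShift F x₀ X i n p)) atTop (𝓝 c) := by
    rintro r hr ⟨c, hc⟩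
    -- the compensated product decreases along the trajectory to a positive limit
    have hanti := (antitone_prod_Ico (hR i) (hle i) hr).comp_monotone
      (monotone_of_win (z := fun n => X n p.1) hp.2 i)
    have hlow := exp_neg_shiftCgf_le_prod_Ico (hsum i) (hR i) (hle i) hr
    have hlim := tendsto_atTop_ciInf hanti ⟨_, by
      rintro _ ⟨n, rfl⟩
      exact hlow _⟩
    have hpos := (Real.exp_pos _).trans_le (ge_of_tendsto' hlim fun n => hlow _)
    refine ⟨_, (hc.div hlim hpos.ne').congr fun n => ?_⟩
    rw [Pi.div_apply, expMart_single]
    exact mul_div_cancel_right₀ _ ((Real.exp_pos _).trans_le (hlow _)).ne'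
  obtain ⟨a, ha⟩ := key _ hhalf h1
  obtain ⟨b, hb⟩ := key _ hhalf' h2
  exact tendsto_of_tendsto_exp (half_pos (hR i)) ha hb

/-- Convergence of integrals under uniform integrability, in the form of tail bounds by
truncation. -/
theorem lintegral_eq_of_tendsto_of_truncation {α : Type*} [MeasurableSpace α] {μ : Measure α}
    [IsFiniteMeasure μ] {f : ℕ → α → ℝ≥0∞} {g : α → ℝ≥0∞} {c : ℝ≥0∞}
    (hf : ∀ n, Measurable (f n)) (hlim : ∀ᵐ a ∂μ, Tendsto (fun n => f n a) atTop (𝓝 (g a)))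
    (hc : ∀ n, ∫⁻ a, f n a ∂μ = c)
    (htrunc : ∀ δ : NNReal, 0 < δ → ∃ K : ℝ≥0∞, K ≠ ∞ ∧
      ∀ n, ∫⁻ a, f n a ∂μ ≤ ∫⁻ a, min (f n a) K ∂μ + δ) :
    ∫⁻ a, g a ∂μ = c := by
  apply le_antisymm
  · calc ∫⁻ a, g a ∂μ = ∫⁻ a, liminf (fun n => f n a) atTop ∂μ :=
          lintegral_congr_ae (hlim.mono fun a ha => ha.liminf_eq.symm)
      _ ≤ liminf (fun n => ∫⁻ a, f n a ∂μ) atTop := lintegral_liminf_le hf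
      _ = c := by simp [hc]
  · refine ENNReal.le_of_forall_pos_le_add fun δ hδ _ => ?_
    obtain ⟨K, hK, h⟩ := htrunc δ hδ
    have ht : Tendsto (fun n => ∫⁻ a, min (f n a) K ∂μ) atTop (𝓝 (∫⁻ a, min (g a) K ∂μ)) := by
      refine tendsto_lintegral_of_dominated_convergence (fun _ => K)
        (fun n => (hf n).min measurable_const)
        (fun n => Eventually.of_forall fun a => min_le_right _ _)
        ?_ (hlim.mono fun a ha => ha.min tendsto_const_nhds)
      rw [lintegral_const]
      exact ENNReal.mul_ne_top hK (measure_ne_top μ _)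
    have h2 : c ≤ ∫⁻ a, min (g a) K ∂μ + δ :=
      ge_of_tendsto' (ht.add_const _) fun n => (hc n).symm.le.trans (h n)
    exact h2.trans (by gcongr; exact min_le_left _ _)

/-- Truncation at level `K` loses at most `K ^ (1 - q) z ^ q`. -/
theorem le_min_add_rpow {z K q : ℝ} (hz : 0 ≤ z) (hK : 0 < K) (hq : 1 < q) :
    z ≤ min z K + K ^ (1 - q) * z ^ q := by
  rcases le_total z K with h | h
  · rw [min_eq_left h]
    have : 0 ≤ K ^ (1 - q) * z ^ q := by positivity
    linarith
  · have hz0 : 0 < z := hK.trans_le h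
    have h1 : z = z ^ (1 - q) * z ^ q := by
      rw [← Real.rpow_add hz0]; simp
    have h2 : z ^ (1 - q) * z ^ q ≤ K ^ (1 - q) * z ^ q := by
      gcongr ?_ * _
      exact Real.rpow_le_rpow_of_nonpos hK h (by linarith)
    have h3 : 0 ≤ min z K := le_min hz hK.le
    linarith

theorem abs_lt_rate {F : ℕ → ℝ} {x : ℕ} {R s : ℝ} (hle : ∀ k, R ≤ F (x + k))
    (hs : |s| < R) (k : ℕ) (hk : x ≤ k) : |s| < F k := by
  obtain ⟨m, rfl⟩ := Nat.exists_eq_add_of_le hk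
  exact hs.trans_le (hle m)

/-- The joint moment generating function of the limits of the time shifts. -/
theorem lintegral_exp_sum_limit (hX : IsPolyaUrn (fun _ => F) x₀ P X)
    [IsProbabilityMeasure P] [Nonempty (Fin A)] (hF : ∀ k, 1 ≤ k → 0 < F k)
    (hx₀ : ∀ i, 1 ≤ x₀ i) (hsum : ∀ i, Summable (fun k : ℕ => 1 / F (x₀ i + k) ^ 2))
    {R : Fin A → ℝ} (hR : ∀ i, 0 < R i) (hle : ∀ i k, R i ≤ F (x₀ i + k))
    {U : Fin A → Ω × (ℕ → ℝ) → ℝ}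
    (hU : ∀ᵐ p ∂(P.prod expNoise), ∀ i,
      Tendsto (fun n => timeShift F x₀ X i n p) atTop (𝓝 (U i p)))
    (hXtop : ∀ᵐ p ∂(P.prod expNoise), ∀ i, Tendsto (fun n => X n p.1 i) atTop atTop)
    {s : Fin A → ℝ} (hs : ∀ i, |s i| < R i) :
    ∫⁻ p, ENNReal.ofReal (Real.exp (∑ i, s i * U i p)) ∂(P.prod expNoise) =
      ENNReal.ofReal (Real.exp (∑ i, shiftCgf F (x₀ i) (s i))) := by
  obtain ⟨q, hq, hqs⟩ : ∃ q : ℝ, 1 < q ∧ ∀ i, |q * s i| < R i := by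
    have h : ∀ᶠ q : ℝ in 𝓝 1, ∀ i, |q * s i| < R i := by
      refine eventually_all.2 fun i => ?_
      have hc : Continuous fun q : ℝ => |q * s i| := by fun_prop
      exact hc.continuousAt.eventually_lt continuousAt_const (by simpa using hs i)
    obtain ⟨q, h1, h2⟩ := ((h.filter_mono nhdsWithin_le_nhds).and
      (self_mem_nhdsWithin (s := Set.Ioi (1 : ℝ)))).exists
    exact ⟨q, h2, h1⟩
  have hs' := fun i => abs_lt_rate (hle i) (hs i)
  have hqs' := fun i => abs_lt_rate (hle i) (hqs i)
  have hlim := lintegral_eq_of_tendsto_of_truncation (μ := P.prod expNoise) (c := 1)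
    (f := fun n p => ENNReal.ofReal (expMart F x₀ s X n p))
    (g := fun p => ENNReal.ofReal (Real.exp (∑ i, s i * U i p)) *
      ENNReal.ofReal (Real.exp (-∑ i, shiftCgf F (x₀ i) (s i))))
    (fun n => (measurable_expMart hX.measurable n).ennreal_ofReal) ?_
    (lintegral_expMart hX hF hx₀ hs') ?_
  · rw [lintegral_mul_const' _ _ ENNReal.ofReal_ne_top] at hlim
    have h1 := congrArg (· * ENNReal.ofReal (Real.exp (∑ i, shiftCgf F (x₀ i) (s i)))) hlim
    simp only [mul_assoc, one_mul] at h1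
    rwa [← ENNReal.ofReal_mul (Real.exp_nonneg _), ← Real.exp_add, neg_add_cancel, Real.exp_zero,
      ENNReal.ofReal_one, mul_one] at h1
  · filter_upwards [hU, hXtop] with p h1 h2
    rw [← ENNReal.ofReal_mul (Real.exp_nonneg _), Real.exp_sum, ← Finset.sum_neg_distrib,
      Real.exp_sum, ← Finset.prod_mul_distrib]
    simp_rw [expMart_eq_prod]
    refine ENNReal.tendsto_ofReal (tendsto_finsetProd _ fun i _ => ?_)
    exact (((h1 i).const_mul (s i)).rexp).mul
      ((tendsto_prod_Ico (hsum i) (hR i) (hle i) (hs i)).comp (h2 i))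
  -- uniform integrability: `expMart` is bounded in `L^q`, so truncation at large `K` costs little
  · intro δ hδ
    set C := Real.exp (∑ i, shiftCgf F (x₀ i) (q * s i))
    have ht : Tendsto (fun K : ℝ => K ^ (1 - q) * C) atTop (𝓝 0) := by
      have := (tendsto_rpow_neg_atTop (y := q - 1) (by linarith)).mul_const C
      simpa using this
    obtain ⟨K, hK, hK0⟩ := ((ht.eventually_lt_const (show (0 : ℝ) < δ from hδ)).and
      (eventually_gt_atTop 0)).exists
    refine ⟨ENNReal.ofReal K, ENNReal.ofReal_ne_top, fun n => ?_⟩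
    have hq1 := lintegral_expMart hX hF hx₀ hqs' n
    have hmq := (measurable_expMart (F := F) (x₀ := x₀) (s := fun i => q * s i)
      hX.measurable n).ennreal_ofReal
    calc ∫⁻ p, ENNReal.ofReal (expMart F x₀ s X n p) ∂(P.prod expNoise)
        ≤ ∫⁻ p, (min (ENNReal.ofReal (expMart F x₀ s X n p)) (ENNReal.ofReal K) +
            (δ : ℝ≥0∞) * ENNReal.ofReal (expMart F x₀ (fun i => q * s i) X n p))
            ∂(P.prod expNoise) := by
          refine lintegral_mono fun p => ?_
          have h0 := expMart_nonneg (X := X) hF hx₀ hs' n p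
          have h0q := expMart_nonneg (X := X) hF hx₀ hqs' n p
          rw [← ENNReal.ofReal_min, ← ENNReal.ofReal_coe_nnreal, ← ENNReal.ofReal_mul δ.coe_nonneg,
            ← ENNReal.ofReal_add (le_min h0 hK0.le) (mul_nonneg δ.coe_nonneg h0q)]
          refine ENNReal.ofReal_le_ofReal ((le_min_add_rpow h0 hK0 hq).trans ?_)
          refine add_le_add le_rfl ?_
          calc K ^ (1 - q) * expMart F x₀ s X n p ^ q
              ≤ K ^ (1 - q) * (C * expMart F x₀ (fun i => q * s i) X n p) := by
                gcongr
                exact expMart_rpow_le hsum hR hle hq hs hqs n p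
            _ = (K ^ (1 - q) * C) * expMart F x₀ (fun i => q * s i) X n p := by ring
            _ ≤ _ := by gcongr
      _ = _ := by
          rw [lintegral_add_right _ (hmq.const_mul _), lintegral_const_mul _ hmq, hq1, mul_one]

end

/-- Variables whose joint moment generating function factorizes near the origin are independent:
for each direction `t`, the functions `z ↦ E exp (z ∑ t i U i)` and `z ↦ ∏ E exp (z t i U i)` are
holomorphic on a strip around the imaginary axis and agree on a real interval, hence agree at
`z = I`, where they are characteristic functions. -/
theorem iIndepFun_of_mgf_eq_prod {Ω : Type*} [MeasurableSpace Ω] {μ : Measure Ω}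
    [IsProbabilityMeasure μ] {ι : Type*} [Fintype ι] {U : ι → Ω → ℝ} (hU : ∀ i, Measurable (U i))
    {ε : ℝ} (hε : 0 < ε)
    (hint : ∀ s : ι → ℝ, (∀ i, |s i| < ε) → Integrable (fun ω => Real.exp (∑ i, s i * U i ω)) μ)
    (hmgf : ∀ s : ι → ℝ, (∀ i, |s i| < ε) →
      ∫ ω, Real.exp (∑ i, s i * U i ω) ∂μ = ∏ i, mgf (U i) μ (s i)) : iIndepFun U μ := by
  classical
  rw [iIndepFun_iff_charFun_pi fun i => (hU i).aemeasurable]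
  intro t
  set L : Ω → ℝ := fun ω => ∑ i, t.ofLp i * U i ω with hL
  have hLm : Measurable L := Finset.measurable_sum _ fun i _ => (hU i).const_mul _
  obtain ⟨δ, hδ, hδt⟩ : ∃ δ > 0, ∀ r : ℝ, |r| < δ → ∀ i, |r * t.ofLp i| < ε := by
    refine ⟨ε / (1 + ∑ i, |t.ofLp i|), by positivity, fun r hr i => ?_⟩
    rw [lt_div_iff₀ (by positivity)] at hr
    rw [abs_mul]
    refine lt_of_le_of_lt ?_ hr
    gcongr
    have := Finset.single_le_sum (f := fun i => |t.ofLp i|) (fun _ _ => abs_nonneg _)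
      (Finset.mem_univ i)
    linarith
  have hone : ∀ i, ∀ r : ℝ, |r| < ε → r ∈ integrableExpSet (U i) μ := by
    intro i r hr
    have h := hint (Pi.single i r) fun j => by
      rcases eq_or_ne j i with rfl | hj
      · simpa using hr
      · simpa [Pi.single_eq_of_ne hj] using hε
    change Integrable _ μ
    simpa [Pi.single_apply] using h
  have hball : ∀ i, ∀ r : ℝ, |r| < ε → r ∈ interior (integrableExpSet (U i) μ) := by
    intro i r hr
    refine mem_interior.2 ⟨{r | |r| < ε}, fun r hr => hone i r hr, ?_, hr⟩
    exact isOpen_lt continuous_abs continuous_const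
  have hLball : ∀ r : ℝ, |r| < δ → r ∈ interior (integrableExpSet L μ) := by
    intro r hr
    refine mem_interior.2 ⟨{r | |r| < δ}, fun r hr => ?_,
      isOpen_lt continuous_abs continuous_const, hr⟩
    have h := hint (fun i => r * t.ofLp i) (hδt r hr)
    change Integrable _ μ
    simpa only [hL, Finset.mul_sum, mul_assoc] using h
  set S : Set ℂ := {z | |z.re| < δ} with hS
  have hSo : IsOpen S := isOpen_lt (by fun_prop) continuous_const
  have hSc : IsPreconnected S := by
    have : S = Complex.reLm ⁻¹' (Set.Ioo (-δ) δ) := by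
      ext z; simp [hS, abs_lt]
    rw [this]
    exact ((convex_Ioo _ _).linear_preimage _).isPreconnected
  have hf : AnalyticOnNhd ℂ (complexMGF L μ) S :=
    DifferentiableOn.analyticOnNhd
      (differentiableOn_complexMGF.mono fun z hz => hLball z.re hz) hSo
  have hg : AnalyticOnNhd ℂ (fun z : ℂ => ∏ i, complexMGF (U i) μ (z * t.ofLp i)) S := by
    refine DifferentiableOn.analyticOnNhd (DifferentiableOn.fun_finsetProd fun i _ => ?_) hSo
    refine differentiableOn_complexMGF.comp (by fun_prop) fun z hz => ?_
    exact hball i _ (by simpa using hδt z.re hz i)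
  have hreal : ∀ r : ℝ, |r| < δ →
      complexMGF L μ r = ∏ i, complexMGF (U i) μ (r * t.ofLp i) := by
    intro r hr
    simp only [← Complex.ofReal_mul, complexMGF_ofReal]
    rw [← Complex.ofReal_prod, ← hmgf _ (hδt r hr), mgf]
    simp only [hL, Finset.mul_sum, mul_assoc]
  have hfreq : ∃ᶠ z in 𝓝[≠] (0 : ℂ),
      complexMGF L μ z = ∏ i, complexMGF (U i) μ (z * t.ofLp i) := by
    have ht : Tendsto (fun r : ℝ => (r : ℂ)) (𝓝[≠] 0) (𝓝[≠] 0) := by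
      refine tendsto_nhdsWithin_iff.2 ⟨?_, ?_⟩
      · exact (Complex.continuous_ofReal.tendsto' 0 0 (by simp)).mono_left nhdsWithin_le_nhds
      · filter_upwards [self_mem_nhdsWithin] with r hr
        simpa using hr
    refine ht.frequently (Eventually.frequently ?_)
    have : ∀ᶠ r : ℝ in 𝓝 0, |r| < δ :=
      (continuous_abs.tendsto' 0 0 (by simp)).eventually_lt_const hδ
    exact (this.filter_mono nhdsWithin_le_nhds).mono fun r hr => hreal r hr
  have heq := hf.eqOn_of_preconnected_of_frequently_eq hg hSc (z₀ := 0) (by simpa [hS] using hδ)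
    hfreq
  have hI : Complex.I ∈ S := by simpa [hS] using hδ
  have h1 := heq hI
  have h2 : complexMGF L μ Complex.I =
      charFun (μ.map fun ω => WithLp.toLp 2 fun i => U i ω) t := by
    rw [charFun_apply, integral_map (by fun_prop) (by fun_prop), complexMGF]
    congr 1 with ω
    rw [PiLp.inner_apply]
    congr 1
    simp [hL, mul_comm]
  rw [← h2, h1]
  refine Finset.prod_congr rfl fun i _ => ?_
  rw [mul_comm, complexMGF_mul_I (hU i).aemeasurable]

end

/-! ### The limit theorem -/

theorem shiftCgf_zero (F : ℕ → ℝ) (x : ℕ) : shiftCgf F x 0 = 0 := by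
  simp [shiftCgf]

theorem mainTheorem10 {A : ℕ} (hA : 2 ≤ A) (F : ℕ → ℝ) (hF : ∀ k, 1 ≤ k → 0 < F k)
    (hnonexpl : ¬ Summable (fun k : ℕ => 1 / F (k + 1)))
    (hsuper : Tendsto (fun k : ℕ => F k / (k : ℝ)) atTop atTop)
    (x₀ : Fin A → ℕ) (hx₀ : ∀ i, 1 ≤ x₀ i)
    {Ω : Type u} [MeasurableSpace Ω] (P : Measure Ω) [IsProbabilityMeasure P]
    (X : ℕ → Ω → Fin A → ℕ) (hX : IsPolyaUrn (fun _ => F) x₀ P X) :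
    -- an extension `ext : (Ω', P') → (Ω, P)` of the probability space carrying the variables `U i`
    ∃ (Ω' : Type u) (_ : MeasurableSpace Ω') (P' : Measure Ω') (_ : IsProbabilityMeasure P')
      (ext : Ω' → Ω) (U : Fin A → Ω' → ℝ),
      MeasurePreserving ext P' P ∧
      (∀ i, Measurable (U i)) ∧
      iIndepFun U P' ∧
      (∀ᵐ ω ∂P', Tendsto
        (fun (n : ℕ) (i : Fin A) =>
          urnClock F (x₀ i) (n : ℝ) - urnClock F (x₀ i) (X n (ext ω) i : ℝ))
        atTop
        (𝓝 fun i : Fin A =>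
          (U i ω - ∑ k ∈ Finset.Ico 1 (x₀ i), 1 / F k) -
            ⨅ j : Fin A, (U j ω - ∑ k ∈ Finset.Ico 1 (x₀ j), 1 / F k))) ∧
      (∀ i,
        (∀ l : ℕ, 2 ≤ l → Summable (fun k : ℕ => 1 / F (x₀ i + k) ^ l)) ∧
        ∃ R : ℝ, IsLeast (F '' Set.Ici (x₀ i)) R ∧
          (FormalMultilinearSeries.ofScalars ℝ (cgfCoeff F (x₀ i))).radius = ENNReal.ofReal R ∧
          ∀ s : ℝ, |s| < R →
            Integrable (fun ω => Real.exp (s * U i ω)) P' ∧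
            HasSum (fun l : ℕ => cgfCoeff F (x₀ i) l * s ^ l) (cgf (U i) P' s)) := by
  have : Nonempty (Fin A) := ⟨⟨0, by omega⟩⟩
  have hsum : ∀ (i : Fin A) (l : ℕ), 2 ≤ l → Summable fun k : ℕ => 1 / F (x₀ i + k) ^ l :=
    fun i l hl => summable_one_div_rate_pow hsuper (x₀ i) hl
  choose R hRleast using fun i => exists_isLeast_rate (tendsto_rate_atTop hsuper) (x₀ i)
  have hle : ∀ i k, R i ≤ F (x₀ i + k) := fun i k => (hRleast i).2 ⟨_, Nat.le_add_right _ _, rfl⟩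
  have hmem : ∀ i, ∃ k, F (x₀ i + k) = R i := by
    intro i
    obtain ⟨m, hm, hmR⟩ := (hRleast i).1
    obtain ⟨k, rfl⟩ := Nat.exists_eq_add_of_le (Set.mem_Ici.1 hm)
    exact ⟨k, hmR⟩
  have hR : ∀ i, 0 < R i := by
    intro i
    obtain ⟨k, hk⟩ := hmem i
    rw [← hk]
    exact hF _ ((hx₀ i).trans (Nat.le_add_right _ _))
  have hsum2 := fun i => hsum i 2 le_rfl
  set μ := P.prod expNoise
  choose U hUm hU using fun i => measurable_limit_of_tendsto_metrizable_ae (μ := μ)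
    (fun n => (measurable_timeShift (F := F) (x₀ := x₀) hX.measurable i n).aemeasurable)
    (ae_exists_tendsto_timeShift hX hF hx₀ hsum2 hR hle i)
  have hpath := ((ae_all_iff.2 hU).and (ae_trajectory hX hF hx₀)).mono fun p h =>
    tendsto_atTop_and_urnClock_sub hF hnonexpl hsuper hx₀ (X := fun n => X n p.1) h.2.1 h.2.2 h.1
  have hjoint : ∀ s : Fin A → ℝ, (∀ i, |s i| < R i) →
      Integrable (fun p => Real.exp (∑ i, s i * U i p)) μ ∧
      ∫ p, Real.exp (∑ i, s i * U i p) ∂μ = ∏ i, Real.exp (shiftCgf F (x₀ i) (s i)) := by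
    intro s hs
    have h := lintegral_exp_sum_limit hX hF hx₀ hsum2 hR hle (ae_all_iff.2 hU)
      (hpath.mono fun p hp => hp.1) hs
    have hm : Measurable fun p => Real.exp (∑ i, s i * U i p) :=
      (Finset.measurable_sum _ fun i _ => (hUm i).const_mul _).exp
    have h0 : 0 ≤ᵐ[μ] fun p => Real.exp (∑ i, s i * U i p) :=
      Eventually.of_forall fun p => Real.exp_nonneg _
    refine ⟨⟨hm.aestronglyMeasurable, ?_⟩, ?_⟩
    · rw [hasFiniteIntegral_iff_ofReal h0, h]
      exact ENNReal.ofReal_lt_top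
    · rw [integral_eq_lintegral_of_nonneg_ae h0 hm.aestronglyMeasurable, h,
        ENNReal.toReal_ofReal (Real.exp_nonneg _), Real.exp_sum]
  have hsingle : ∀ i (s : ℝ), |s| < R i → Integrable (fun p => Real.exp (s * U i p)) μ ∧
      mgf (U i) μ s = Real.exp (shiftCgf F (x₀ i) s) := by
    intro i s hs
    have h := hjoint (Pi.single i s) fun j => by
      rcases eq_or_ne j i with rfl | hj
      · simpa using hs
      · simpa [Pi.single_eq_of_ne hj] using hR j
    have h1 : ∀ p, ∑ j, (Pi.single i s : Fin A → ℝ) j * U j p = s * U i p := fun p => by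
      simp [Pi.single_apply]
    have h2 : ∏ j, Real.exp (shiftCgf F (x₀ j) ((Pi.single i s : Fin A → ℝ) j)) =
        Real.exp (shiftCgf F (x₀ i) s) := by
      rw [Finset.prod_eq_single i (fun j _ hj => by
        rw [Pi.single_eq_of_ne hj, shiftCgf_zero, Real.exp_zero]) (by simp), Pi.single_eq_same]
    simp only [h1, h2] at h
    exact h
  obtain ⟨i₀, -, hi₀⟩ := Finset.exists_min_image Finset.univ R Finset.univ_nonempty
  have hmin : ∀ i, R i₀ ≤ R i := fun i => hi₀ i (Finset.mem_univ i)
  refine ⟨Ω × (ℕ → ℝ), inferInstance, μ, inferInstance, Prod.fst, U, measurePreserving_fst, hUm,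
    ?_, hpath.mono fun p hp => hp.2, fun i => ⟨hsum i, R i, hRleast i, ?_, fun s hs => ?_⟩⟩
  · refine iIndepFun_of_mgf_eq_prod hUm (hR i₀)
      (fun s hs => (hjoint s fun i => (hs i).trans_le (hmin i)).1) fun s hs => ?_
    rw [(hjoint s fun i => (hs i).trans_le (hmin i)).2]
    exact Finset.prod_congr rfl fun i _ => (hsingle i (s i) ((hs i).trans_le (hmin i))).2.symm
  · exact cgfCoeff_radius (hsum i) (hR i) (hle i) (hmem i)
  · refine ⟨(hsingle i s hs).1, ?_⟩
    rw [cgf, (hsingle i s hs).2, Real.log_exp]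
    exact hasSum_cgfCoeff (hsum i) (hR i) (hle i) hs
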